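/- A compact metric graph $\Gamma$ consists of finitely many vertices and finitely many edges $e$, each an interval $[0,\ell_e]$ with $\ell_e>0$ whose two endpoints are glued to vertices (loops, multiple edges and several components are allowed). $\mathbf L(\Gamma)$ denotes the operator $-\frac{d^2}{dx^2}$ in $L^2(\Gamma)$ on the functions that are $H^2$ on each edge, are continuous at each vertex, and whose normal derivatives (taken from the vertex into the edges) sum to zero at each vertex. Two graphs are isospectral if their operators $\mathbf L$ have the same spectrum with the same multiplicities. For a vertex $v$ of $\Gamma$, the Titchmarsh–Weyl $M$-function of $\Gamma$ at $v$ is the partial function of $k\in\mathbb C$ with $M(k)\,u(v)=u'(v)$ for all $u$ that are continuous on $\Gamma$, satisfy $-u''=k^2u$ on every edge, and have normal derivatives summing to zero at every vertex other than $v$; here $u'(v)$ is the sum of the normal derivatives of $u$ at $v$, and $M(k)$ is undefined if $u(v)=0$ for all such $u$. Let $n\ge 1$, $d\ge 1$ and $\ell_1,\dots,\ell_n>0$. The pumpkin chain $C_d(\ell_1,\dots,\ell_n)$ of degree $d$ has vertices $v_0,\dots,v_n$ and, for each $i=1,\dots,n$, exactly $d$ edges, all of length $\ell_i$, joining $v_{i-1}$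 to $v_i$; its ends are $v_0$ and $v_n$. **Theorem 2.** (1) For every permutation $\sigma$ of $\{1,\dots,n\}$, the chains $C=C_d(\ell_1,\dots,\ell_n)$ and $C^\sigma=C_d(\ell_{\sigma(1)},\dots,\ell_{\sigma(n)})$ are isospectral. They remain isospectral if two compact metric graphs $\Gamma_1,\Gamma_2$ are attached to both of them, by identifying $v_0$ with a vertex $a$ of $\Gamma_1$ and $v_n$ with a vertex $b$ of $\Gamma_2$; and also if a single compact metric graph $\Gamma$ is attached to both of them, by identifying $v_0$ with a vertex $a$ and $v_n$ with a vertex $b$ of $\Gamma$ (where $a=b$ is allowed). (2) Each end of $C$ is a hot vertex: the $M$-functions of $C$ at $v_0$ and at $v_n$ coincide, and for every compact metric graph $\Gamma$ and every vertex $a$ of $\Gamma$, the graph obtained from $C$ and $\Gamma$ by identifying $a$ with $v_0$ is isospectral to the one obtained by identifying $a$ with $v_n$. -/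

import Mathlib

open MeasureTheory Set

/-! ### Finite compact metric graphs -/

/-- A finite compact metric graph: finitely many vertices and finitely many edges; the edge `e`
is the interval `[0, len e]`, glued at `0` to the vertex `src e` and at `len e` to `tgt e`.
Loops, parallel edges and several connected components are allowed. -/
structure MetricGraph where
  /-- vertices -/
  V : Type
  /-- edges -/
  E : Type
  finV : Finite V
  fintypeE : Fintype E
  /-- the vertex at the endpoint `0` of an edge -/
  src : E → V
  /-- the vertex at the endpoint `len e` of an edge -/
  tgt : E → V
  /-- length of an edge -/
  len : E → ℝ
  len_pos : ∀ e, 0 < len e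

attribute [instance] MetricGraph.finV MetricGraph.fintypeE

namespace MetricGraph

variable (Γ : MetricGraph)

/-- The Hilbert space `L²(Γ)`, the direct sum of the spaces `L²([0, len e]; ℂ)`. -/
abbrev L2 : Type :=
  PiLp 2 (fun e : Γ.E => Lp ℂ 2 ((volume : Measure ℝ).restrict (Icc 0 (Γ.len e))))

open Classical in
/-- The sum over all edge ends at `v` of the normal derivatives of a function on `Γ`, each of them
taken from `v` into the edge; `F' e` is the derivative on the edge `e`. -/
noncomputable def normalDerivSum (F' : Γ.E → ℝ → ℂ) (v : Γ.V) : ℂ :=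
  ∑ e, ((if Γ.src e = v then F' e 0 else 0) - (if Γ.tgt e = v then F' e (Γ.len e) else 0))

/-- The function `F` on the edges is continuous at every vertex, with the value `φ v` at `v`. -/
def HasVertexValues (F : Γ.E → ℝ → ℂ) (φ : Γ.V → ℂ) : Prop :=
  ∀ e, F e 0 = φ (Γ.src e) ∧ F e (Γ.len e) = φ (Γ.tgt e)

/-- `f` is in the domain of the Laplacian with standard vertex conditions and `g = -f''`:
on every edge `f` has a `C¹` representative `F` whose derivative `F'` is the indefinite integral of
the square integrable function `-g` (so `f` is in `H²` of the edge), `F` is continuous at the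
vertices, and at each vertex the normal derivatives sum to zero. -/
def IsLaplacianPair (f g : Γ.L2) : Prop :=
  ∃ (F F' : Γ.E → ℝ → ℂ) (φ : Γ.V → ℂ),
    (∀ e, f e =ᵐ[volume.restrict (Icc 0 (Γ.len e))] F e) ∧
    (∀ e, ∀ x ∈ Icc 0 (Γ.len e), HasDerivWithinAt (F e) (F' e x) (Icc 0 (Γ.len e)) x) ∧
    (∀ e, ∀ x ∈ Icc 0 (Γ.len e), F' e x = F' e 0 - ∫ t in (0 : ℝ)..x, g e t) ∧
    Γ.HasVertexValues F φ ∧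
    ∀ v, Γ.normalDerivSum F' v = 0

variable {Γ}

theorem intervalIntegrable_coe (g : Γ.L2) (e : Γ.E) {x : ℝ} (hx : x ∈ Icc 0 (Γ.len e)) :
    IntervalIntegrable (g e) volume 0 x := by
  have h : IntegrableOn (g e) (Icc 0 (Γ.len e)) volume :=
    (Lp.memLp (g e)).integrable (by norm_num)
  rw [intervalIntegrable_iff_integrableOn_Ioc_of_le hx.1]
  exact h.mono_set (Ioc_subset_Icc_self.trans (Icc_subset_Icc_right hx.2))

theorem integral_congr_edge {u w : ℝ → ℂ} {l x : ℝ} (hx : x ∈ Icc 0 l)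
    (h : u =ᵐ[volume.restrict (Icc 0 l)] w) :
    ∫ t in (0 : ℝ)..x, u t = ∫ t in (0 : ℝ)..x, w t := by
  rw [intervalIntegral.integral_of_le hx.1, intervalIntegral.integral_of_le hx.1]
  exact integral_congr_ae (ae_restrict_of_ae_restrict_of_subset
    (Ioc_subset_Icc_self.trans (Icc_subset_Icc_right hx.2)) h)

theorem IsLaplacianPair.zero : Γ.IsLaplacianPair 0 0 := by
  refine ⟨fun _ _ => 0, fun _ _ => 0, fun _ => 0, fun e => ?_, fun e x _ => ?_, fun e x hx => ?_,
    fun e => ⟨rfl, rfl⟩, fun v => ?_⟩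
  · exact Lp.coeFn_zero _ _ _
  · exact hasDerivWithinAt_const _ _ _
  · have := integral_congr_edge hx
      (Lp.coeFn_zero ℂ 2 ((volume : Measure ℝ).restrict (Icc 0 (Γ.len e))))
    simpa using this
  · simp [normalDerivSum]

theorem IsLaplacianPair.add {f₁ g₁ f₂ g₂ : Γ.L2} (h₁ : Γ.IsLaplacianPair f₁ g₁)
    (h₂ : Γ.IsLaplacianPair f₂ g₂) : Γ.IsLaplacianPair (f₁ + f₂) (g₁ + g₂) := by
  obtain ⟨F₁, F₁', φ₁, a₁, b₁, c₁, d₁, k₁⟩ := h₁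
  obtain ⟨F₂, F₂', φ₂, a₂, b₂, c₂, d₂, k₂⟩ := h₂
  refine ⟨fun e x => F₁ e x + F₂ e x, fun e x => F₁' e x + F₂' e x, fun v => φ₁ v + φ₂ v,
    fun e => ?_, fun e x hx => (b₁ e x hx).add (b₂ e x hx), fun e x hx => ?_,
    fun e => ?_, fun v => ?_⟩
  · filter_upwards [Lp.coeFn_add (f₁ e) (f₂ e), a₁ e, a₂ e] with x hx h1 h2
    simpa [h1, h2] using hx
  · have h : ∫ t in (0 : ℝ)..x, (g₁ + g₂) e t = ∫ t in (0 : ℝ)..x, (g₁ e t + g₂ e t) :=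
      integral_congr_edge hx (Lp.coeFn_add (g₁ e) (g₂ e))
    rw [h, intervalIntegral.integral_add (intervalIntegrable_coe g₁ e hx)
      (intervalIntegrable_coe g₂ e hx)]
    simp only
    rw [c₁ e x hx, c₂ e x hx]
    ring
  · simp only [d₁ e, d₂ e, and_self]
  · have h := congrArg₂ (· + ·) (k₁ v) (k₂ v)
    simp only [normalDerivSum, ← Finset.sum_add_distrib, add_zero] at h ⊢
    refine Eq.trans (Finset.sum_congr rfl fun e _ => ?_) h
    split_ifs <;> ring

theorem IsLaplacianPair.smul (c : ℂ) {f g : Γ.L2} (h : Γ.IsLaplacianPair f g) :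
    Γ.IsLaplacianPair (c • f) (c • g) := by
  obtain ⟨F, F', φ, a, b, c', d, k⟩ := h
  refine ⟨fun e x => c * F e x, fun e x => c * F' e x, fun v => c * φ v,
    fun e => ?_, fun e x hx => (b e x hx).const_mul c, fun e x hx => ?_, fun e => ?_, fun v => ?_⟩
  · filter_upwards [Lp.coeFn_smul c (f e), a e] with x hx h1
    simpa [h1] using hx
  · have h : ∫ t in (0 : ℝ)..x, (c • g) e t = ∫ t in (0 : ℝ)..x, c * g e t :=
      integral_congr_edge hx (Lp.coeFn_smul c (g e))
    rw [h, intervalIntegral.integral_const_mul]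
    simp only
    rw [c' e x hx]
    ring
  · simp only [d e, and_self]
  · have h := congrArg (c * ·) (k v)
    simp only [normalDerivSum, Finset.mul_sum, mul_zero] at h ⊢
    refine Eq.trans (Finset.sum_congr rfl fun e _ => ?_) h
    split_ifs <;> ring

/-- `-f''` is determined by `f`. -/
theorem IsLaplacianPair.eq_zero {g : Γ.L2} (h : Γ.IsLaplacianPair 0 g) : g = 0 := by
  obtain ⟨F, F', φ, a, b, c, -, -⟩ := h
  ext1 e
  have hl := Γ.len_pos e
  have hF0 : ∀ x ∈ Icc 0 (Γ.len e), F e x = 0 := by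
    have hae : F e =ᵐ[volume.restrict (Icc 0 (Γ.len e))] fun _ => 0 :=
      (a e).symm.trans (Lp.coeFn_zero _ _ _)
    have hc : ContinuousOn (F e) (Icc 0 (Γ.len e)) := fun x hx => (b e x hx).continuousWithinAt
    exact Measure.eqOn_Icc_of_ae_eq volume hl.ne hae hc continuousOn_const
  have hF'0 : ∀ x ∈ Icc 0 (Γ.len e), F' e x = 0 := fun x hx => by
    have h0 : HasDerivWithinAt (F e) 0 (Icc 0 (Γ.len e)) x :=
      (hasDerivWithinAt_const x _ (0 : ℂ)).congr hF0 (hF0 x hx)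
    exact (uniqueDiffOn_Icc hl x hx).eq_deriv _ (b e x hx) h0
  have hint : ∀ x ∈ Icc 0 (Γ.len e), ∫ t in (0 : ℝ)..x, g e t = 0 := fun x hx => by
    have := c e x hx
    rw [hF'0 x hx, hF'0 0 (left_mem_Icc.2 hl.le)] at this
    simpa using this.symm
  have hI := intervalIntegrable_coe g e (right_mem_Icc.2 hl.le)
  rw [PiLp.zero_apply]
  apply Lp.ext
  refine Filter.EventuallyEq.trans ?_ (Lp.coeFn_zero _ _ _).symm
  have key := hI.ae_hasDerivAt_integral
  have hcomp : ∀ᵐ x ∂(volume.restrict (Icc 0 (Γ.len e))), x ∈ Ioo 0 (Γ.len e) := by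
    rw [← restrict_Ioo_eq_restrict_Icc]
    exact ae_restrict_mem measurableSet_Ioo
  filter_upwards [ae_restrict_of_ae key, hcomp] with x hx hx'
  have h1 := hx (by rw [uIcc_of_le hl.le]; exact Ioo_subset_Icc_self hx') 0
    (by rw [uIcc_of_le hl.le]; exact left_mem_Icc.2 hl.le)
  have h2 : HasDerivAt (fun y => ∫ t in (0 : ℝ)..y, g e t) 0 x :=
    (hasDerivAt_const x (0 : ℂ)).congr_of_eventuallyEq <| by
      filter_upwards [Ioo_mem_nhds hx'.1 hx'.2] with y hy
      exact hint y (Ioo_subset_Icc_self hy)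
  exact h1.unique h2

variable (Γ)

/-- The graph, in `L²(Γ) × L²(Γ)`, of the Laplacian. -/
noncomputable def laplacianGraph : Submodule ℂ (Γ.L2 × Γ.L2) where
  carrier := {p | Γ.IsLaplacianPair p.1 p.2}
  zero_mem' := IsLaplacianPair.zero
  add_mem' := IsLaplacianPair.add
  smul_mem' := fun c _ h => IsLaplacianPair.smul c h

/-- The operator `L(Γ) = -d²/dx²` in `L²(Γ)` with standard (Neumann) vertex conditions. -/
noncomputable def laplacian : Γ.L2 →ₗ.[ℂ] Γ.L2 := Γ.laplacianGraph.toLinearPMap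

theorem graph_laplacian : Γ.laplacian.graph = Γ.laplacianGraph :=
  Submodule.toLinearPMap_graph_eq _ fun x hx h0 => by
    obtain ⟨f, g⟩ := x
    obtain rfl : f = 0 := h0
    exact IsLaplacianPair.eq_zero hx

end MetricGraph

/-! ### Spectrum and multiplicities of an unbounded operator -/

section Spectrum

variable {H : Type} [NormedAddCommGroup H] [InnerProductSpace ℂ H]

/-- The resolvent set of an unbounded operator: `z` such that `T - z` has a bounded two-sided
inverse defined on the whole space. -/
def opResolventSet (T : H →ₗ.[ℂ] H) : Set ℂ :=
  {z | ∃ R : H →L[ℂ] H,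
    (∀ g, ∃ h : R g ∈ T.domain, T ⟨R g, h⟩ - z • R g = g) ∧
    (∀ f : T.domain, R (T f - z • (f : H)) = f)}

/-- The spectrum of an unbounded operator. -/
def opSpectrum (T : H →ₗ.[ℂ] H) : Set ℂ := (opResolventSet T)ᶜ

/-- The eigenspace `{f ∈ dom T : T f = z f}`. -/
def opEigenspace (T : H →ₗ.[ℂ] H) (z : ℂ) : Submodule ℂ H :=
  (LinearMap.ker (T.toFun - z • T.domain.subtype)).map T.domain.subtype

end Spectrum

namespace MetricGraph

/-- Two metric graphs are isospectral: their Laplacians have the same spectrum, with the same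
multiplicities of all eigenvalues. -/
def Isospectral (Γ₁ Γ₂ : MetricGraph) : Prop :=
  opSpectrum Γ₁.laplacian = opSpectrum Γ₂.laplacian ∧
  ∀ z : ℂ, Module.rank ℂ (opEigenspace Γ₁.laplacian z) =
    Module.rank ℂ (opEigenspace Γ₂.laplacian z)

/-! ### The Titchmarsh–Weyl `M`-function at one boundary vertex -/

/-- `F`, with derivative `F'` and vertex values `φ`, satisfies `-F'' = k² F` on every edge, is
continuous at all vertices, and satisfies the Neumann condition at all vertices other than `v`. -/
structure IsInteriorSolution (Γ : MetricGraph) (v : Γ.V) (k : ℂ)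
    (F F' : Γ.E → ℝ → ℂ) (φ : Γ.V → ℂ) : Prop where
  deriv_fst : ∀ e, ∀ x ∈ Icc 0 (Γ.len e), HasDerivWithinAt (F e) (F' e x) (Icc 0 (Γ.len e)) x
  deriv_snd : ∀ e, ∀ x ∈ Icc 0 (Γ.len e),
    HasDerivWithinAt (F' e) (-(k ^ 2 * F e x)) (Icc 0 (Γ.len e)) x
  vertexValues : Γ.HasVertexValues F φ
  neumann : ∀ w, w ≠ v → Γ.normalDerivSum F' w = 0

/-- `m` is the value at `k` of the `M`-function at `v`: some solution does not vanish at `v`, and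
`m * u(v)` is the sum of the normal derivatives of `u` at `v`, for every solution `u`. -/
def IsMValue (Γ : MetricGraph) (v : Γ.V) (k m : ℂ) : Prop :=
  (∃ F F' φ, Γ.IsInteriorSolution v k F F' φ ∧ φ v ≠ 0) ∧
  ∀ F F' φ, Γ.IsInteriorSolution v k F F' φ → m * φ v = Γ.normalDerivSum F' v

/-- The `M`-function of `Γ` at the boundary vertex `v`, a partial function of `k`: it is undefined
at the `k` for which all solutions vanish at `v`. -/
noncomputable def mFunction (Γ : MetricGraph) (v : Γ.V) : ℂ →. ℂ :=
  fun k => ⟨∃ m, Γ.IsMValue v k m, fun h => h.choose⟩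

/-! ### Constructions of metric graphs -/

/-- The disjoint union of two metric graphs. -/
def disjUnion (Γ₁ Γ₂ : MetricGraph) : MetricGraph where
  V := Γ₁.V ⊕ Γ₂.V
  E := Γ₁.E ⊕ Γ₂.E
  finV := inferInstance
  fintypeE := inferInstance
  src := Sum.map Γ₁.src Γ₂.src
  tgt := Sum.map Γ₁.tgt Γ₂.tgt
  len := Sum.elim Γ₁.len Γ₂.len
  len_pos := by
    rintro (e | e)
    · exact Γ₁.len_pos e
    · exact Γ₂.len_pos e

/-- Identify vertices of a metric graph along (the equivalence relation generated by) `r`. -/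
def identify (Γ : MetricGraph) (r : Γ.V → Γ.V → Prop) : MetricGraph where
  V := Quot r
  E := Γ.E
  finV := Finite.of_surjective _ Quot.mk_surjective
  fintypeE := Γ.fintypeE
  src := fun e => Quot.mk r (Γ.src e)
  tgt := fun e => Quot.mk r (Γ.tgt e)
  len := Γ.len
  len_pos := Γ.len_pos

/-- `Γ` attached to `C` by identifying the vertex `p` of `C` with the vertex `a` of `Γ`. -/
def attach (C : MetricGraph) (p : C.V) (Γ : MetricGraph) (a : Γ.V) : MetricGraph :=
  (C.disjUnion Γ).identify fun x y => x = Sum.inl p ∧ y = Sum.inr a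

/-- `Γ` attached to `C` by identifying the vertices `p`, `q` of `C` with the vertices `a`, `b` of
`Γ`, respectively. -/
def attachTwo (C : MetricGraph) (p q : C.V) (Γ : MetricGraph) (a b : Γ.V) : MetricGraph :=
  (C.disjUnion Γ).identify fun x y =>
    (x = Sum.inl p ∧ y = Sum.inr a) ∨ (x = Sum.inl q ∧ y = Sum.inr b)

/-- The graphs `Γ₁` and `Γ₂` attached to `C` by identifying the vertex `p` of `C` with the vertex
`a` of `Γ₁`, and the vertex `q` of `C` with the vertex `b` of `Γ₂`. -/
def attachPair (C : MetricGraph) (p q : C.V) (Γ₁ : MetricGraph) (a : Γ₁.V)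
    (Γ₂ : MetricGraph) (b : Γ₂.V) : MetricGraph :=
  C.attachTwo p q (Γ₁.disjUnion Γ₂) (Sum.inl a) (Sum.inr b)

/-- The chain of `n` pumpkin graphs of degree `d`: the vertices are `0, …, n`, and the `i`-th
pumpkin consists of `d` parallel edges of length `ℓ i` from vertex `i` to vertex `i + 1`. -/
def pumpkinChain (d : ℕ) {n : ℕ} (ℓ : Fin n → ℝ) (hℓ : ∀ i, 0 < ℓ i) : MetricGraph where
  V := Fin (n + 1)
  E := Fin n × Fin d
  finV := inferInstance
  fintypeE := inferInstance
  src := fun e => e.1.castSucc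
  tgt := fun e => e.1.succ
  len := fun e => ℓ e.1
  len_pos := fun e => hℓ e.1

/-- The first end of a chain of pumpkin graphs. -/
def chainFirst (d : ℕ) {n : ℕ} (ℓ : Fin n → ℝ) (hℓ : ∀ i, 0 < ℓ i) : (pumpkinChain d ℓ hℓ).V :=
  (0 : Fin (n + 1))

/-- The last end of a chain of pumpkin graphs. -/
def chainLast (d : ℕ) {n : ℕ} (ℓ : Fin n → ℝ) (hℓ : ∀ i, 0 < ℓ i) : (pumpkinChain d ℓ hℓ).V :=
  Fin.last n

end MetricGraph

/-!
A function on a chain of pumpkins of degree `d` is the sum of its mean over the `d` parallel edges of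
each pumpkin and of a part with mean zero. Continuity at the vertices forces the part with mean zero
to vanish at all vertices, and it does not contribute to the sums of normal derivatives, so on each
pumpkin it lives independently of everything else. Since all degrees are equal, the Kirchhoff
conditions at the inner vertices say exactly that the means, placed one after the other, form an `H²`
function `s` on an interval of length `∑ i, ℓ i`, which no longer remembers the breakpoints.

Hence there is an explicit isomorphism of the `L²` spaces of two chains with the same multiset of
lengths: reflect `s` as a whole, cut it at the new breakpoints, and add the parts with mean zero,
moved from pumpkin to pumpkin (`reflectChain`, `reflectChainL2`). It commutes with `-d²/dx²` and
exchanges the values and the sums of normal derivatives at the two ends (`isWeakPair_reflectChain`),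
so the chains are "boundary equivalent" with exchanged ends (`boundaryEquivalent_reflect`). Two such
reflections permute the pumpkins and keep the ends (`boundaryEquivalent_permute`); one reflection of
a chain to itself shows that its ends are hot.

A boundary equivalence extends by the identity to whatever is glued to the boundary, because the
vertex conditions of the glued graph see the chain only through its boundary data
(`Intertwines.glue`). So the Laplacians of the glued graphs are similar, and have the same resolvent
set and isomorphic eigenspaces (`isospectral_of_equiv`); no spectral theory is needed.
-/

/-! ### Spectrum and multiplicities under similarity -/

section Similarity

variable {H₁ H₂ : Type} [NormedAddCommGroup H₁] [InnerProductSpace ℂ H₁]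
  [NormedAddCommGroup H₂] [InnerProductSpace ℂ H₂]

/-- The resolvent set in terms of the graph of the operator, the form in which it is transported. -/
theorem mem_opResolventSet_iff {T : H₁ →ₗ.[ℂ] H₁} {z : ℂ} :
    z ∈ opResolventSet T ↔ ∃ R : H₁ →L[ℂ] H₁,
      (∀ g, (R g, g + z • R g) ∈ T.graph) ∧ ∀ f h, (f, h) ∈ T.graph → R (h - z • f) = f := by
  constructor
  · rintro ⟨R, h1, h2⟩
    refine ⟨R, fun g => ?_, fun f h hf => ?_⟩
    · obtain ⟨hg, h⟩ := h1 g
      exact (T.mem_graph_iff).2 ⟨⟨R g, hg⟩, rfl, sub_eq_iff_eq_add.1 h⟩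
    · obtain ⟨y, rfl, rfl⟩ := (T.mem_graph_iff).1 hf
      exact h2 y
  · rintro ⟨R, h1, h2⟩
    refine ⟨R, fun g => ?_, fun f => h2 _ _ (T.mem_graph f)⟩
    obtain ⟨⟨y, hy⟩, h, h'⟩ := (T.mem_graph_iff).1 (h1 g)
    obtain rfl : y = R g := h
    exact ⟨hy, by simp only [h', add_sub_cancel_right]⟩

theorem mem_opEigenspace_iff {T : H₁ →ₗ.[ℂ] H₁} {z : ℂ} {f : H₁} :
    f ∈ opEigenspace T z ↔ (f, z • f) ∈ T.graph := by
  rw [opEigenspace, Submodule.mem_map, T.mem_graph_iff]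
  refine exists_congr fun y => ?_
  simp only [LinearMap.mem_ker, LinearMap.sub_apply, LinearMap.smul_apply, Submodule.subtype_apply,
    LinearPMap.toFun_eq_coe, sub_eq_zero]
  constructor
  · rintro ⟨h, rfl⟩
    exact ⟨rfl, h⟩
  · rintro ⟨rfl, h⟩
    exact ⟨h, rfl⟩

theorem opResolventSet_subset_of_equiv {T₁ : H₁ →ₗ.[ℂ] H₁} {T₂ : H₂ →ₗ.[ℂ] H₂} (U : H₁ ≃L[ℂ] H₂)
    (h : ∀ f g, (f, g) ∈ T₁.graph ↔ (U f, U g) ∈ T₂.graph) :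
    opResolventSet T₁ ⊆ opResolventSet T₂ := by
  intro z hz
  obtain ⟨R, h1, h2⟩ := mem_opResolventSet_iff.1 hz
  refine mem_opResolventSet_iff.2
    ⟨(U : H₁ →L[ℂ] H₂) ∘L R ∘L (U.symm : H₂ →L[ℂ] H₁), fun g => ?_, fun f k hf => ?_⟩
  · simpa using (h _ _).1 (h1 (U.symm g))
  · have := h2 (U.symm f) (U.symm k) ((h _ _).2 (by simpa using hf))
    rw [← map_smul, ← map_sub] at this
    exact (congrArg U this).trans (U.apply_symm_apply f)

theorem opEigenspace_rank_eq_of_equiv {T₁ : H₁ →ₗ.[ℂ] H₁} {T₂ : H₂ →ₗ.[ℂ] H₂} (U : H₁ ≃L[ℂ] H₂)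
    (h : ∀ f g, (f, g) ∈ T₁.graph ↔ (U f, U g) ∈ T₂.graph) (z : ℂ) :
    Module.rank ℂ (opEigenspace T₁ z) = Module.rank ℂ (opEigenspace T₂ z) := by
  have hcard := (U.toLinearEquiv.submoduleMap (opEigenspace T₁ z)).lift_rank_eq
  have hmap : (opEigenspace T₁ z).map (U.toLinearEquiv : H₁ →ₗ[ℂ] H₂) = opEigenspace T₂ z := by
    ext f
    rw [Submodule.mem_map, mem_opEigenspace_iff]
    constructor
    · rintro ⟨y, hy, rfl⟩
      simpa using (h _ _).1 (mem_opEigenspace_iff.1 hy)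
    · intro hf
      refine ⟨U.symm f, mem_opEigenspace_iff.2 ((h _ _).2 (by simpa using hf)), by simp⟩
  rw [hmap] at hcard
  simpa using hcard

end Similarity

namespace MetricGraph

theorem mem_graph_laplacian {Γ : MetricGraph} {f g : Γ.L2} :
    (f, g) ∈ Γ.laplacian.graph ↔ Γ.IsLaplacianPair f g := by
  rw [graph_laplacian]; rfl

/-- Similar Laplacians have the same spectrum and multiplicities. -/
theorem isospectral_of_equiv {Γ₁ Γ₂ : MetricGraph} (U : Γ₁.L2 ≃L[ℂ] Γ₂.L2)
    (h₁ : ∀ f g, Γ₁.IsLaplacianPair f g → Γ₂.IsLaplacianPair (U f) (U g))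
    (h₂ : ∀ f g, Γ₂.IsLaplacianPair f g → Γ₁.IsLaplacianPair (U.symm f) (U.symm g)) :
    Γ₁.Isospectral Γ₂ := by
  have h : ∀ f g, (f, g) ∈ Γ₁.laplacian.graph ↔ (U f, U g) ∈ Γ₂.laplacian.graph := fun f g => by
    simp only [mem_graph_laplacian]
    exact ⟨h₁ f g, fun h => by simpa using h₂ _ _ h⟩
  have h' : ∀ f g, (f, g) ∈ Γ₂.laplacian.graph ↔ (U.symm f, U.symm g) ∈ Γ₁.laplacian.graph :=
    fun f g => by simp [h]
  exact ⟨congrArg compl ((opResolventSet_subset_of_equiv U h).antisymm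
    (opResolventSet_subset_of_equiv U.symm h')), opEigenspace_rank_eq_of_equiv U h⟩

end MetricGraph

/-! ### Reflection operators between edges -/

theorem ae_indicator_comp_sub_left {u w : ℝ → ℂ} {a : ℝ}
    (h : u =ᵐ[volume.restrict (Icc 0 a)] w) (c : ℝ) :
    (fun x => (Icc 0 a).indicator u (c - x)) =ᵐ[volume] fun x => (Icc 0 a).indicator w (c - x) := by
  have h' : (Icc 0 a).indicator u =ᵐ[volume] (Icc 0 a).indicator w :=
    (ae_eq_restrict_iff_indicator_ae_eq measurableSet_Icc).1 h
  exact (Measure.measurePreserving_sub_left volume c).quasiMeasurePreserving.ae_eq_comp h'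

theorem memLp_indicator_comp_sub_left {u : ℝ → ℂ} {a : ℝ}
    (h : MemLp u 2 (volume.restrict (Icc 0 a))) (c b : ℝ) :
    MemLp (fun x => (Icc 0 a).indicator u (c - x)) 2 (volume.restrict (Icc 0 b)) :=
  (((memLp_indicator_iff_restrict measurableSet_Icc).2 h).comp_measurePreserving
    (Measure.measurePreserving_sub_left volume c)).restrict _

theorem eLpNorm_indicator_comp_sub_left_le {u : ℝ → ℂ} {a : ℝ}
    (h : MemLp u 2 (volume.restrict (Icc 0 a))) (c b : ℝ) :
    eLpNorm (fun x => (Icc 0 a).indicator u (c - x)) 2 (volume.restrict (Icc 0 b)) ≤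
      eLpNorm u 2 (volume.restrict (Icc 0 a)) := by
  refine (eLpNorm_restrict_le _ _ _ _).trans ?_
  rw [← eLpNorm_indicator_eq_eLpNorm_restrict measurableSet_Icc]
  exact (eLpNorm_comp_measurePreserving
    ((memLp_indicator_iff_restrict measurableSet_Icc).2 h).aestronglyMeasurable
    (Measure.measurePreserving_sub_left volume c)).le

/-- The operator from `L²[0, a]` to `L²[0, b]` that extends a function by zero to the real line,
reflects it by `x ↦ c - x`, and restricts it. -/
noncomputable def reflectLp (a b c : ℝ) :
    Lp ℂ 2 ((volume : Measure ℝ).restrict (Icc 0 a)) →L[ℂ]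
      Lp ℂ 2 ((volume : Measure ℝ).restrict (Icc 0 b)) :=
  LinearMap.mkContinuous
    { toFun := fun f => (memLp_indicator_comp_sub_left (Lp.memLp f) c b).toLp _
      map_add' := fun f g => by
        rw [← MemLp.toLp_add]
        refine MemLp.toLp_congr _ _ (ae_restrict_of_ae ?_)
        refine (ae_indicator_comp_sub_left (Lp.coeFn_add f g) c).trans (.of_forall fun x => ?_)
        simp only [indicator_add', Pi.add_apply]
      map_smul' := fun z f => by
        rw [RingHom.id_apply, ← MemLp.toLp_const_smul]
        refine MemLp.toLp_congr _ _ (ae_restrict_of_ae ?_)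
        refine (ae_indicator_comp_sub_left (Lp.coeFn_smul z f) c).trans (.of_forall fun x => ?_)
        simp only [Pi.smul_apply, indicator_const_smul_apply, Pi.smul_def] } 1
    fun f => by
      rw [one_mul, LinearMap.coe_mk, AddHom.coe_mk, Lp.norm_toLp, Lp.norm_def]
      exact ENNReal.toReal_mono (Lp.eLpNorm_ne_top f)
        (eLpNorm_indicator_comp_sub_left_le (Lp.memLp f) c b)

theorem coeFn_reflectLp (a b c : ℝ) (f : Lp ℂ 2 ((volume : Measure ℝ).restrict (Icc 0 a))) :
    reflectLp a b c f =ᵐ[volume.restrict (Icc 0 b)]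
      fun x => (Icc 0 a).indicator f (c - x) :=
  MemLp.coeFn_toLp (memLp_indicator_comp_sub_left (Lp.memLp f) c b)

namespace MetricGraph

variable {Γ₁ Γ₂ : MetricGraph}

/-- Transplantation of functions on the edges of `Γ₁` to those of `Γ₂`: the function on the edge
`e'` is the combination with coefficients `w e' e` of the functions on the edges `e`, extended by
zero to the real line and reflected by `x ↦ c e' e - x`. -/
noncomputable def transplant (w : Γ₂.E → Γ₁.E → ℂ) (c : Γ₂.E → Γ₁.E → ℝ)
    (F : Γ₁.E → ℝ → ℂ) (e' : Γ₂.E) (x : ℝ) : ℂ :=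
  ∑ e, w e' e * (Icc 0 (Γ₁.len e)).indicator (F e) (c e' e - x)

/-- `transplant` as a bounded operator between the `L²` spaces. -/
noncomputable def transplantL2 (w : Γ₂.E → Γ₁.E → ℂ) (c : Γ₂.E → Γ₁.E → ℝ) :
    Γ₁.L2 →L[ℂ] Γ₂.L2 :=
  (PiLp.continuousLinearEquiv 2 ℂ fun e : Γ₂.E =>
      Lp ℂ 2 ((volume : Measure ℝ).restrict (Icc 0 (Γ₂.len e)))).symm.toContinuousLinearMap ∘L
    ContinuousLinearMap.pi fun e' =>
      ∑ e, w e' e • (reflectLp (Γ₁.len e) (Γ₂.len e') (c e' e) ∘L PiLp.proj 2 _ e)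

theorem transplant_congr (w : Γ₂.E → Γ₁.E → ℂ) (c : Γ₂.E → Γ₁.E → ℝ) {F G : Γ₁.E → ℝ → ℂ}
    (h : ∀ e, F e =ᵐ[volume.restrict (Icc 0 (Γ₁.len e))] G e) (e' : Γ₂.E) :
    transplant w c F e' =ᵐ[volume] transplant w c G e' := by
  have := fun e => ae_indicator_comp_sub_left (h e) (c e' e)
  filter_upwards [ae_all_iff.2 this] with x hx
  exact Finset.sum_congr rfl fun e _ => by rw [hx e]

theorem coeFn_transplantL2 (w : Γ₂.E → Γ₁.E → ℂ) (c : Γ₂.E → Γ₁.E → ℝ) (f : Γ₁.L2) (e' : Γ₂.E) :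
    transplantL2 w c f e' =ᵐ[volume.restrict (Icc 0 (Γ₂.len e'))]
      transplant w c (fun e => f e) e' := by
  have h0 : transplantL2 w c f e' =
      ∑ e, w e' e • reflectLp (Γ₁.len e) (Γ₂.len e') (c e' e) (f e) := by
    simp [transplantL2]
  rw [h0]
  refine (Lp.coeFn_finsetSum _ _).trans ?_
  have h1 := fun e => Lp.coeFn_smul (w e' e) (reflectLp (Γ₁.len e) (Γ₂.len e') (c e' e) (f e))
  have h2 := fun e => coeFn_reflectLp (Γ₁.len e) (Γ₂.len e') (c e' e) (f e)
  filter_upwards [ae_all_iff.2 h1, ae_all_iff.2 h2] with x hx1 hx2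
  simp only [Finset.sum_apply, transplant]
  refine Finset.sum_congr rfl fun e _ => ?_
  rw [hx1, Pi.smul_apply, hx2, smul_eq_mul]

end MetricGraph

/-! ### Functions with prescribed vertex data -/

namespace MetricGraph

variable {Γ : MetricGraph}

/-- `F` has the derivative `F'` and `g = -F''` in the integrated sense on every edge, the values of
`F` at the vertices are `φ`, and the sums of its normal derivatives are `η`. -/
structure IsWeakPair (Γ : MetricGraph) (F F' g : Γ.E → ℝ → ℂ) (φ η : Γ.V → ℂ) : Prop where
  integrable : ∀ e, IntegrableOn (g e) (Icc 0 (Γ.len e))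
  deriv_fst : ∀ e, ∀ x ∈ Icc 0 (Γ.len e), HasDerivWithinAt (F e) (F' e x) (Icc 0 (Γ.len e)) x
  deriv_snd : ∀ e, ∀ x ∈ Icc 0 (Γ.len e), F' e x = F' e 0 - ∫ t in (0 : ℝ)..x, g e t
  vertexValues : Γ.HasVertexValues F φ
  normalDeriv : ∀ v, Γ.normalDerivSum F' v = η v

theorem IsWeakPair.congr {F F' g g₁ : Γ.E → ℝ → ℂ} {φ η : Γ.V → ℂ}
    (h : Γ.IsWeakPair F F' g φ η) (hg : ∀ e, g e =ᵐ[volume.restrict (Icc 0 (Γ.len e))] g₁ e) :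
    Γ.IsWeakPair F F' g₁ φ η where
  integrable e := (h.integrable e).congr (hg e)
  deriv_fst := h.deriv_fst
  deriv_snd e x hx := by rw [h.deriv_snd e x hx, integral_congr_edge hx (hg e)]
  vertexValues := h.vertexValues
  normalDeriv := h.normalDeriv

/-- `f` is `H²` on every edge and continuous on `Γ`, `g = -f''`, and `f` has the vertex values `φ`
and the sums `η` of normal derivatives. -/
def IsBoundaryPair (Γ : MetricGraph) (f g : Γ.L2) (φ η : Γ.V → ℂ) : Prop :=
  ∃ F F' : Γ.E → ℝ → ℂ, (∀ e, f e =ᵐ[volume.restrict (Icc 0 (Γ.len e))] F e) ∧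
    Γ.IsWeakPair F F' (fun e => g e) φ η

theorem integrableOn_coe (g : Γ.L2) (e : Γ.E) : IntegrableOn (g e) (Icc 0 (Γ.len e)) :=
  (Lp.memLp (g e)).integrable (by norm_num)

/-- A Laplacian pair is a pair whose sums of normal derivatives are all zero. -/
theorem isLaplacianPair_iff {f g : Γ.L2} :
    Γ.IsLaplacianPair f g ↔ ∃ φ, Γ.IsBoundaryPair f g φ 0 := by
  constructor
  · rintro ⟨F, F', φ, a, b, c, d, k⟩
    exact ⟨φ, F, F', a, integrableOn_coe g, b, c, d, k⟩
  · rintro ⟨φ, F, F', a, h⟩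
    exact ⟨F, F', φ, a, h.deriv_fst, h.deriv_snd, h.vertexValues, h.normalDeriv⟩

/-- The pairing of the normal derivatives with a test function `ψ` on the vertices. -/
noncomputable def fluxPairing (Γ : MetricGraph) (F' : Γ.E → ℝ → ℂ) (ψ : Γ.V → ℂ) : ℂ :=
  ∑ e, (ψ (Γ.src e) * F' e 0 - ψ (Γ.tgt e) * F' e (Γ.len e))

open Classical in
theorem fluxPairing_single (F' : Γ.E → ℝ → ℂ) (v : Γ.V) :
    Γ.fluxPairing F' (Pi.single v 1) = Γ.normalDerivSum F' v := by
  simp only [fluxPairing, normalDerivSum, Pi.single_apply, ite_mul, one_mul, zero_mul]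

theorem fluxPairing_eq_sum [Fintype Γ.V] (F' : Γ.E → ℝ → ℂ) (ψ : Γ.V → ℂ) :
    Γ.fluxPairing F' ψ = ∑ v, ψ v * Γ.normalDerivSum F' v := by
  classical
  simp only [fluxPairing, normalDerivSum, Finset.mul_sum]
  rw [Finset.sum_comm]
  refine Finset.sum_congr rfl fun e _ => ?_
  simp [mul_sub, Finset.sum_sub_distrib]

theorem fluxPairing_eq_zero {F' : Γ.E → ℝ → ℂ} (h : ∀ v, Γ.normalDerivSum F' v = 0)
    (ψ : Γ.V → ℂ) : Γ.fluxPairing F' ψ = 0 := by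
  let _ := Fintype.ofFinite Γ.V
  simp [fluxPairing_eq_sum, h]

theorem fluxPairing_eq_sum_boundary {B : Type} [Fintype B] {p : B → Γ.V}
    (hp : Function.Injective p) {F' : Γ.E → ℝ → ℂ}
    (h : ∀ v ∉ range p, Γ.normalDerivSum F' v = 0) (ψ : Γ.V → ℂ) :
    Γ.fluxPairing F' ψ = ∑ b, ψ (p b) * Γ.normalDerivSum F' (p b) := by
  classical
  let _ := Fintype.ofFinite Γ.V
  rw [fluxPairing_eq_sum, ← Finset.sum_image (f := fun v => ψ v * Γ.normalDerivSum F' v)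
    (s := Finset.univ) (g := p) hp.injOn]
  refine (Finset.sum_subset (Finset.subset_univ _) fun v _ hv => ?_).symm
  rw [h v (by simpa using hv), mul_zero]

/-! ### Boundary equivalence -/

section BoundaryEquivalence

variable {B : Type} {C₁ C₂ C₃ : MetricGraph} {p₁ : B → C₁.V} {p₂ : B → C₂.V} {p₃ : B → C₃.V}

/-- `U` maps the functions on `C₁` with Kirchhoff conditions off the boundary vertices `p₁` to such
functions on `C₂`, commutes with `-d²/dx²`, and preserves the boundary values and the sums of normal
derivatives at the boundary vertices. -/
def Intertwines (p₁ : B → C₁.V) (p₂ : B → C₂.V) (U : C₁.L2 →L[ℂ] C₂.L2) : Prop :=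
  ∀ f g φ η, C₁.IsBoundaryPair f g φ η → (∀ v ∉ range p₁, η v = 0) →
    ∃ φ' η', C₂.IsBoundaryPair (U f) (U g) φ' η' ∧ (∀ v ∉ range p₂, η' v = 0) ∧
      (∀ b, φ' (p₂ b) = φ (p₁ b)) ∧ ∀ b, η' (p₂ b) = η (p₁ b)

theorem Intertwines.comp {U : C₁.L2 →L[ℂ] C₂.L2} {W : C₂.L2 →L[ℂ] C₃.L2}
    (hW : Intertwines p₂ p₃ W) (hU : Intertwines p₁ p₂ U) : Intertwines p₁ p₃ (W ∘L U) := by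
  intro f g φ η h h0
  obtain ⟨φ₂, η₂, h₂, k₂, a₂, b₂⟩ := hU f g φ η h h0
  obtain ⟨φ₃, η₃, h₃, k₃, a₃, b₃⟩ := hW _ _ _ _ h₂ k₂
  exact ⟨φ₃, η₃, h₃, k₃, fun b => (a₃ b).trans (a₂ b), fun b => (b₃ b).trans (b₂ b)⟩

/-- The graphs `C₁` and `C₂` with boundary vertices `p₁` and `p₂` have similar maximal operators,
by a similarity that preserves the boundary data. -/
def BoundaryEquivalent (p₁ : B → C₁.V) (p₂ : B → C₂.V) : Prop :=
  ∃ U : C₁.L2 ≃L[ℂ] C₂.L2, Intertwines p₁ p₂ (U : C₁.L2 →L[ℂ] C₂.L2) ∧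
    Intertwines p₂ p₁ (U.symm : C₂.L2 →L[ℂ] C₁.L2)

theorem BoundaryEquivalent.symm (h : BoundaryEquivalent p₁ p₂) : BoundaryEquivalent p₂ p₁ := by
  obtain ⟨U, h₁, h₂⟩ := h
  exact ⟨U.symm, h₂, h₁⟩

theorem BoundaryEquivalent.trans (h : BoundaryEquivalent p₁ p₂) (k : BoundaryEquivalent p₂ p₃) :
    BoundaryEquivalent p₁ p₃ := by
  obtain ⟨U, h₁, h₂⟩ := h
  obtain ⟨W, k₁, k₂⟩ := k
  refine ⟨U.trans W, ?_, ?_⟩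
  · rw [← ContinuousLinearEquiv.comp_coe]
    exact k₁.comp h₁
  · rw [show (U.trans W).symm = W.symm.trans U.symm from rfl, ← ContinuousLinearEquiv.comp_coe]
    exact h₂.comp k₂

theorem Intertwines.isLaplacianPair {U : C₁.L2 →L[ℂ] C₂.L2} (hU : Intertwines p₁ p₂ U)
    {f g : C₁.L2} (h : C₁.IsLaplacianPair f g) : C₂.IsLaplacianPair (U f) (U g) := by
  obtain ⟨φ, h⟩ := isLaplacianPair_iff.1 h
  obtain ⟨φ', η', h', k, -, b⟩ := hU _ _ _ _ h fun _ _ => rfl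
  obtain rfl : η' = 0 := by
    funext v
    by_cases hv : v ∈ range p₂
    · obtain ⟨b', rfl⟩ := hv
      exact b b'
    · exact k v hv
  exact isLaplacianPair_iff.2 ⟨φ', h'⟩

theorem BoundaryEquivalent.isospectral (h : BoundaryEquivalent p₁ p₂) : C₁.Isospectral C₂ := by
  obtain ⟨U, h₁, h₂⟩ := h
  exact isospectral_of_equiv U (fun _ _ h => h₁.isLaplacianPair h)
    (fun _ _ h => h₂.isLaplacianPair h)

end BoundaryEquivalence

/-! ### Gluing -/

section Gluing

variable {C : MetricGraph}

/-- The `L²` space of a graph glued from `C` and `Γ` is the sum of those of `C` and `Γ`. -/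
noncomputable def splitL2 (r : (C.disjUnion Γ).V → (C.disjUnion Γ).V → Prop) :
    ((C.disjUnion Γ).identify r).L2 ≃L[ℂ] C.L2 × Γ.L2 where
  toFun f := (WithLp.toLp 2 fun e => f (Sum.inl e), WithLp.toLp 2 fun e => f (Sum.inr e))
  invFun p := WithLp.toLp 2 fun e => match e with
    | Sum.inl e => p.1 e
    | Sum.inr e => p.2 e
  left_inv f := by
    ext1 e
    rcases e with e | e <;> rfl
  right_inv p := rfl
  map_add' f g := rfl
  map_smul' c f := rfl
  continuous_toFun := by
    refine Continuous.prodMk ?_ ?_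
    · exact (PiLp.continuous_toLp 2 _).comp (continuous_pi fun e =>
        (PiLp.proj (𝕜 := ℂ) 2 _ (Sum.inl e : C.E ⊕ Γ.E)).continuous)
    · exact (PiLp.continuous_toLp 2 _).comp (continuous_pi fun e =>
        (PiLp.proj (𝕜 := ℂ) 2 _ (Sum.inr e : C.E ⊕ Γ.E)).continuous)
  continuous_invFun := by
    refine (PiLp.continuous_toLp 2 _).comp (continuous_pi fun e => ?_)
    rcases e with e | e
    · exact ((PiLp.proj (𝕜 := ℂ) 2 _ e).continuous).comp continuous_fst
    · exact ((PiLp.proj (𝕜 := ℂ) 2 _ e).continuous).comp continuous_snd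

/-- The vertex functions `φ` on `C` and `ψ` on `Γ` define a function on the glued vertices. -/
def Compat (r : (C.disjUnion Γ).V → (C.disjUnion Γ).V → Prop) (φ : C.V → ℂ) (ψ : Γ.V → ℂ) : Prop :=
  ∀ x y, r x y → Sum.elim φ ψ x = Sum.elim φ ψ y

theorem fluxPairing_glue (r : (C.disjUnion Γ).V → (C.disjUnion Γ).V → Prop)
    (F' : ((C.disjUnion Γ).identify r).E → ℝ → ℂ) (ψ : ((C.disjUnion Γ).identify r).V → ℂ) :
    ((C.disjUnion Γ).identify r).fluxPairing F' ψ =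
      C.fluxPairing (fun e => F' (Sum.inl e)) (fun v => ψ (Quot.mk r (Sum.inl v))) +
      Γ.fluxPairing (fun e => F' (Sum.inr e)) (fun v => ψ (Quot.mk r (Sum.inr v))) :=
  Fintype.sum_sum_type _

variable {B : Type} [Fintype B] {C₁ C₂ : MetricGraph} {p₁ : B → C₁.V} {p₂ : B → C₂.V}

/-- An intertwiner, extended by the identity on `L²(Γ)`, maps the Laplacian of one glued graph into
that of the other. The Kirchhoff conditions are tested against functions on the vertices of the
glued graphs, and such a function acts on `C₁` and `C₂` only through its boundary values. -/
theorem Intertwines.glue (hp₁ : Function.Injective p₁) (hp₂ : Function.Injective p₂)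
    {r₁ : (C₁.disjUnion Γ).V → (C₁.disjUnion Γ).V → Prop}
    {r₂ : (C₂.disjUnion Γ).V → (C₂.disjUnion Γ).V → Prop}
    {A : (B → ℂ) → (Γ.V → ℂ) → Prop}
    (hr₁ : ∀ φ ψ, Compat r₁ φ ψ ↔ A (fun b => φ (p₁ b)) ψ)
    (hr₂ : ∀ φ ψ, Compat r₂ φ ψ ↔ A (fun b => φ (p₂ b)) ψ)
    {U : C₁.L2 →L[ℂ] C₂.L2} (hU : Intertwines p₁ p₂ U)
    {f g : ((C₁.disjUnion Γ).identify r₁).L2}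
    (h : ((C₁.disjUnion Γ).identify r₁).IsLaplacianPair f g) :
    ((C₂.disjUnion Γ).identify r₂).IsLaplacianPair
      ((splitL2 r₂).symm (U (splitL2 r₁ f).1, (splitL2 r₁ f).2))
      ((splitL2 r₂).symm (U (splitL2 r₁ g).1, (splitL2 r₁ g).2)) := by
  classical
  obtain ⟨F, F', φ, a, b, c, d, k⟩ := h
  have hflux := fluxPairing_eq_zero k
  -- A vertex function on the glued graph can be given on the two pieces.
  have hlift : ∀ α β, Compat r₁ α β →
      C₁.fluxPairing (fun e => F' (Sum.inl e)) α + Γ.fluxPairing (fun e => F' (Sum.inr e)) β = 0 :=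
    fun α β hc => (fluxPairing_glue r₁ F' (Quot.lift (Sum.elim α β) hc)).symm.trans (hflux _)
  have hint : ∀ v ∉ range p₁, C₁.normalDerivSum (fun e => F' (Sum.inl e)) v = 0 := by
    intro v hv
    have h0 : Compat r₁ (0 : C₁.V → ℂ) (0 : Γ.V → ℂ) := fun x y _ => by
      rcases x with x | x <;> rcases y with y | y <;> rfl
    have h1 : Compat r₁ (Pi.single v 1 : C₁.V → ℂ) (0 : Γ.V → ℂ) := by
      rw [hr₁] at h0 ⊢
      convert h0 using 2 with b'
      exact Pi.single_eq_of_ne (fun hb => hv ⟨b', hb⟩) _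
    have h2 := hlift _ _ h1
    rw [fluxPairing_single] at h2
    simpa [fluxPairing] using h2
  obtain ⟨φ', η', ⟨G, G', aG, hG⟩, k', hφ, hη⟩ := hU (splitL2 r₁ f).1 (splitL2 r₁ g).1
    (fun v => φ (Quot.mk r₁ (Sum.inl v))) _
    ⟨fun e => F (Sum.inl e), fun e => F' (Sum.inl e), fun e => a (Sum.inl e),
      integrableOn_coe _, fun e => b (Sum.inl e), fun e => c (Sum.inl e), fun e => d (Sum.inl e),
      fun v => rfl⟩ hint
  have hcompat : Compat r₁ (fun v => φ (Quot.mk r₁ (Sum.inl v)))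
      (fun v => φ (Quot.mk r₁ (Sum.inr v))) := by
    intro x y hxy
    have := congrArg φ (Quot.sound hxy)
    rcases x with x | x <;> rcases y with y | y <;> exact this
  have hcompat' : Compat r₂ φ' (fun v => φ (Quot.mk r₁ (Sum.inr v))) := by
    rw [hr₁] at hcompat
    rw [hr₂]
    simpa only [hφ] using hcompat
  refine ⟨fun e => match e with
      | Sum.inl e => G e
      | Sum.inr e => F (Sum.inr e),
    fun e => match e with
      | Sum.inl e => G' e
      | Sum.inr e => F' (Sum.inr e),
    Quot.lift (Sum.elim φ' fun v => φ (Quot.mk r₁ (Sum.inr v))) hcompat', ?_, ?_, ?_, ?_, ?_⟩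
  · rintro (e | e)
    · exact aG e
    · exact a (Sum.inr e)
  · rintro (e | e)
    · exact hG.deriv_fst e
    · exact b (Sum.inr e)
  · rintro (e | e)
    · exact hG.deriv_snd e
    · exact c (Sum.inr e)
  · rintro (e | e)
    · exact hG.vertexValues e
    · exact d (Sum.inr e)
  · intro v
    rw [← fluxPairing_single, fluxPairing_glue]
    set ψ : ((C₂.disjUnion Γ).identify r₂).V → ℂ := Pi.single v 1
    have hψ : Compat r₂ (fun v => ψ (Quot.mk r₂ (Sum.inl v)))
        (fun v => ψ (Quot.mk r₂ (Sum.inr v))) := by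
      intro x y hxy
      have := congrArg ψ (Quot.sound hxy)
      rcases x with x | x <;> rcases y with y | y <;> exact this
    -- The test function on `C₁` with the same boundary values, extended by zero.
    set α : C₁.V → ℂ := Function.extend p₁ (fun b => ψ (Quot.mk r₂ (Sum.inl (p₂ b)))) 0
    have hα : ∀ b, α (p₁ b) = ψ (Quot.mk r₂ (Sum.inl (p₂ b))) := fun b => hp₁.extend_apply _ _ b
    have h1 := hlift α (fun v => ψ (Quot.mk r₂ (Sum.inr v))) (by
      rw [hr₂] at hψ
      rw [hr₁]
      simpa only [hα] using hψ)
    rw [fluxPairing_eq_sum_boundary hp₁ hint] at h1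
    have h2 := fluxPairing_eq_sum_boundary hp₂ (F' := G')
      (fun v hv => (hG.normalDeriv v).trans (k' v hv)) fun v => ψ (Quot.mk r₂ (Sum.inl v))
    refine (congrArg₂ (· + ·) (h2.trans ?_) rfl).trans h1
    exact Finset.sum_congr rfl fun b _ => by rw [hα, hG.normalDeriv, hη]

/-- Boundary equivalent graphs, glued at the boundary in the same way to a graph `Γ`, give
isospectral graphs. The way of gluing is described by the relation `A` between boundary values and
vertex functions on `Γ` that expresses continuity. -/
theorem BoundaryEquivalent.isospectral_glue (h : BoundaryEquivalent p₁ p₂)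
    (hp₁ : Function.Injective p₁) (hp₂ : Function.Injective p₂)
    {r₁ : (C₁.disjUnion Γ).V → (C₁.disjUnion Γ).V → Prop}
    {r₂ : (C₂.disjUnion Γ).V → (C₂.disjUnion Γ).V → Prop}
    (A : (B → ℂ) → (Γ.V → ℂ) → Prop)
    (hr₁ : ∀ φ ψ, Compat r₁ φ ψ ↔ A (fun b => φ (p₁ b)) ψ)
    (hr₂ : ∀ φ ψ, Compat r₂ φ ψ ↔ A (fun b => φ (p₂ b)) ψ) :
    ((C₁.disjUnion Γ).identify r₁).Isospectral ((C₂.disjUnion Γ).identify r₂) := by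
  obtain ⟨U, h₁, h₂⟩ := h
  exact isospectral_of_equiv
    ((splitL2 r₁).trans ((U.prodCongr (ContinuousLinearEquiv.refl ℂ Γ.L2)).trans (splitL2 r₂).symm))
    (fun _ _ h => h₁.glue hp₁ hp₂ hr₁ hr₂ h) (fun _ _ h => h₂.glue hp₂ hp₁ hr₂ hr₁ h)

end Gluing

end MetricGraph

/-! ### Positions of the vertices of a chain -/

section Positions

variable {n : ℕ} {ℓ : Fin n → ℝ}

theorem zero_ne_last_of_one_le (hn : 1 ≤ n) : (0 : Fin (n + 1)) ≠ Fin.last n := fun h => by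
  have := congrArg Fin.val h
  simp at this
  omega

theorem partialSum_last_eq_sum (ℓ : Fin n → ℝ) : Fin.partialSum ℓ (Fin.last n) = ∑ i, ℓ i := by
  rw [Fin.partialSum, Fin.val_last, List.take_of_length_le (by simp), List.sum_ofFn]

theorem strictMono_partialSum (hℓ : ∀ i, 0 < ℓ i) : StrictMono (Fin.partialSum ℓ) :=
  Fin.strictMono_iff_lt_succ.2 fun i => by
    rw [Fin.partialSum_succ]
    exact lt_add_of_pos_right _ (hℓ i)

theorem partialSum_castSucc_nonneg (hℓ : ∀ i, 0 < ℓ i) (i : Fin n) :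
    0 ≤ Fin.partialSum ℓ i.castSucc := by
  rw [← Fin.partialSum_zero ℓ]
  exact (strictMono_partialSum hℓ).monotone (Fin.zero_le _)

theorem partialSum_castSucc_add_le (hℓ : ∀ i, 0 < ℓ i) (i : Fin n) :
    Fin.partialSum ℓ i.castSucc + ℓ i ≤ ∑ i, ℓ i := by
  rw [← Fin.partialSum_succ, ← partialSum_last_eq_sum]
  exact (strictMono_partialSum hℓ).monotone (Fin.le_last _)

/-- A point of the interval of total length that is not a breakpoint is interior to a piece. -/
theorem exists_mem_Ioo_of_notMem_range {y : ℝ} (hy : y ∈ Icc 0 (∑ i, ℓ i))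
    (hr : y ∉ range (Fin.partialSum ℓ)) :
    ∃ i, y - Fin.partialSum ℓ i.castSucc ∈ Ioo 0 (ℓ i) := by
  have key : ∀ v, y < Fin.partialSum ℓ v →
      ∃ i, y - Fin.partialSum ℓ i.castSucc ∈ Ioo 0 (ℓ i) := by
    intro v
    induction v using Fin.induction with
    | zero => exact fun h => absurd h (by simpa using hy.1)
    | succ k ih =>
      intro h
      rcases lt_trichotomy y (Fin.partialSum ℓ k.castSucc) with h' | h' | h'
      · exact ih h'
      · exact absurd ⟨_, h'.symm⟩ hr
      · rw [Fin.partialSum_succ] at h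
        exact ⟨k, by constructor <;> linarith⟩
  refine key (Fin.last n) (lt_of_le_of_ne ?_ fun h => hr ⟨_, h.symm⟩)
  rw [partialSum_last_eq_sum]
  exact hy.2

theorem ae_sub_notMem_range (ℓ : Fin n → ℝ) (c : ℝ) :
    ∀ᵐ x : ℝ, c - x ∉ range (Fin.partialSum ℓ) := by
  have h : ((fun x => c - x) ⁻¹' range (Fin.partialSum ℓ)).Finite :=
    (finite_range _).preimage sub_right_injective.injOn
  exact measure_eq_zero_iff_ae_notMem.1 (h.measure_zero volume)

end Positions

/-! ### Reflection of chains of pumpkins -/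

namespace MetricGraph

section Chain

variable {n d : ℕ}

/-- The mean of a function on a chain over the `d` parallel edges of the `i`-th pumpkin. -/
noncomputable def chainMean (F : Fin n × Fin d → ℝ → ℂ) (i : Fin n) (x : ℝ) : ℂ :=
  (d : ℂ)⁻¹ * ∑ j, F (i, j) x

/-- The means over the pumpkins, placed one after the other on the real line. At the finitely many
breakpoints the value is not meaningful. -/
noncomputable def concat (ℓ : Fin n → ℝ) (F : Fin n × Fin d → ℝ → ℂ) (y : ℝ) : ℂ :=
  ∑ i, (Icc 0 (ℓ i)).indicator (chainMean F i) (y - Fin.partialSum ℓ i.castSucc)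

/-- Reflection of the functions on the chain with lengths `ℓ` to those on the chain with lengths
`ℓ' = ℓ ∘ σ`: the symmetric part, a function on an interval of length `∑ i, ℓ i`, is reflected as a
whole, and the part of mean zero is moved and reflected edge by edge. -/
noncomputable def reflectChain (ℓ ℓ' : Fin n → ℝ) (σ : Equiv.Perm (Fin n))
    (F : Fin n × Fin d → ℝ → ℂ) (e : Fin n × Fin d) (x : ℝ) : ℂ :=
  concat ℓ F (∑ i, ℓ i - Fin.partialSum ℓ' e.1.castSucc - x) +
    (F (σ e.1, e.2) (ℓ' e.1 - x) - chainMean F (σ e.1) (ℓ' e.1 - x))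

variable {ℓ ℓ' : Fin n → ℝ} {σ : Equiv.Perm (Fin n)}

theorem chainMean_const (hd : 1 ≤ d) {F : Fin n × Fin d → ℝ → ℂ} {i : Fin n} {x : ℝ} {c : ℂ}
    (h : ∀ j, F (i, j) x = c) : chainMean F i x = c := by
  have : (d : ℂ) ≠ 0 := by exact_mod_cast (by omega : d ≠ 0)
  simp [chainMean, h, this]

theorem chainMean_add_sub_mean (hd : 1 ≤ d) (F : Fin n × Fin d → ℝ → ℂ) (k : Fin n) (y : ℝ)
    (c : ℂ) : (d : ℂ)⁻¹ * ∑ j, (c + (F (k, j) y - chainMean F k y)) = c := by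
  have : (d : ℂ) ≠ 0 := by exact_mod_cast (by omega : d ≠ 0)
  simp only [Finset.sum_add_distrib, Finset.sum_sub_distrib, Finset.sum_const, Finset.card_univ,
    Fintype.card_fin, nsmul_eq_mul, chainMean]
  field_simp
  ring

theorem chainMean_reflectChain (hd : 1 ≤ d) (F : Fin n × Fin d → ℝ → ℂ) (i : Fin n) (x : ℝ) :
    chainMean (reflectChain ℓ ℓ' σ F) i x =
      concat ℓ F (∑ i, ℓ i - Fin.partialSum ℓ' i.castSucc - x) := by
  rw [chainMean]
  simp only [reflectChain]
  exact chainMean_add_sub_mean hd F (σ i) (ℓ' i - x) _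

theorem concat_of_mem_Ioo (hℓ : ∀ i, 0 < ℓ i) (F : Fin n × Fin d → ℝ → ℂ) {i : Fin n} {y : ℝ}
    (hy : y - Fin.partialSum ℓ i.castSucc ∈ Ioo 0 (ℓ i)) :
    concat ℓ F y = chainMean F i (y - Fin.partialSum ℓ i.castSucc) := by
  rw [concat, Finset.sum_eq_single i]
  · exact indicator_of_mem (Ioo_subset_Icc_self hy) _
  · intro k _ hk
    refine indicator_of_notMem (fun h => ?_) _
    have hm := (strictMono_partialSum hℓ).monotone
    rcases lt_or_gt_of_ne hk with hlt | hlt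
    · have h1 := hm (show k.succ ≤ i.castSucc from Fin.succ_le_castSucc_iff.2 hlt)
      rw [Fin.partialSum_succ] at h1
      linarith [h.2, hy.1]
    · have h1 := hm (show i.succ ≤ k.castSucc from Fin.succ_le_castSucc_iff.2 hlt)
      rw [Fin.partialSum_succ] at h1
      linarith [h.1, hy.2]
  · simp

/-- Reflecting back, away from the breakpoints, recovers the function. -/
theorem reflectChain_reflectChain (hd : 1 ≤ d) (hℓ : ∀ i, 0 < ℓ i) (hℓ' : ∀ i, 0 < ℓ' i)
    (hσ : ∀ i, ℓ' i = ℓ (σ i)) (F : Fin n × Fin d → ℝ → ℂ) (e : Fin n × Fin d) {x : ℝ}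
    (hx : x ∈ Ioo 0 (ℓ e.1))
    (hr : ∑ i, ℓ i - Fin.partialSum ℓ e.1.castSucc - x ∉ range (Fin.partialSum ℓ')) :
    reflectChain ℓ' ℓ σ⁻¹ (reflectChain ℓ ℓ' σ F) e x = F e x := by
  obtain ⟨i, j⟩ := e
  have hL : ∑ i, ℓ' i = ∑ i, ℓ i := by
    simp only [hσ]
    exact Equiv.sum_comp σ ℓ
  have h0 := partialSum_castSucc_nonneg hℓ i
  have h1 := partialSum_castSucc_add_le hℓ i
  simp only at hx hr
  obtain ⟨k, hk⟩ := exists_mem_Ioo_of_notMem_range (ℓ := ℓ')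
    (y := ∑ i, ℓ i - Fin.partialSum ℓ i.castSucc - x)
    (by rw [hL]; constructor <;> linarith [hx.1, hx.2]) hr
  have h2 : concat ℓ' (reflectChain ℓ ℓ' σ F) (∑ i, ℓ' i - Fin.partialSum ℓ i.castSucc - x) =
      chainMean F i x := by
    rw [hL, concat_of_mem_Ioo hℓ' _ hk, chainMean_reflectChain hd]
    have h3 : ∑ i, ℓ i - Fin.partialSum ℓ' k.castSucc -
        (∑ i, ℓ i - Fin.partialSum ℓ i.castSucc - x - Fin.partialSum ℓ' k.castSucc) -
        Fin.partialSum ℓ i.castSucc = x := by ring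
    rw [concat_of_mem_Ioo (i := i) hℓ _ (by rw [h3]; exact hx), h3]
  have h4 : ℓ' (σ⁻¹ i) - (ℓ i - x) = x := by simp [hσ]
  rw [reflectChain, h2, chainMean_reflectChain hd]
  simp only [reflectChain, h4, show σ (σ⁻¹ i) = i from σ.apply_symm_apply i]
  ring

theorem integrableOn_chainMean {g : Fin n × Fin d → ℝ → ℂ} {i : Fin n} {t : Set ℝ}
    (hg : ∀ j, IntegrableOn (g (i, j)) t) : IntegrableOn (chainMean g i) t :=
  (integrable_finsetSum Finset.univ fun j _ =>
    show Integrable (g (i, j)) (volume.restrict t) from hg j).const_mul _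

theorem integrable_concat {F : Fin n × Fin d → ℝ → ℂ}
    (hF : ∀ e, IntegrableOn (F e) (Icc 0 (ℓ e.1))) : Integrable (concat ℓ F) := by
  refine integrable_finsetSum _ fun i _ => ?_
  have h : IntegrableOn (chainMean F i) (Icc 0 (ℓ i)) := integrableOn_chainMean fun j => hF (i, j)
  exact ((integrable_indicator_iff measurableSet_Icc).2 h).comp_sub_right _

/-- The constant `c` of the reflection `x ↦ c - x` from the coordinate on the edge `e'` of the second
chain to that on the edge `e` of the first one, when the symmetric part is reflected as a whole. -/
noncomputable def symShift (ℓ ℓ' : Fin n → ℝ) (e' e : Fin n × Fin d) : ℝ :=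
  ∑ i, ℓ i - Fin.partialSum ℓ' e'.1.castSucc - Fin.partialSum ℓ e.1.castSucc

/-- The coefficients of the projection to mean zero over parallel edges, followed by the permutation
`σ` of the pumpkins. -/
noncomputable def zeroMeanWeight (σ : Equiv.Perm (Fin n)) (e' e : Fin n × Fin d) : ℂ :=
  if e.1 = σ e'.1 then (if e.2 = e'.2 then 1 else 0) - (d : ℂ)⁻¹ else 0

theorem indicator_chainMean (F : Fin n × Fin d → ℝ → ℂ) (s : Set ℝ) (i : Fin n) (y : ℝ) :
    s.indicator (chainMean F i) y = ∑ j, (d : ℂ)⁻¹ * s.indicator (F (i, j)) y := by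
  by_cases hy : y ∈ s <;> simp [hy, chainMean, Finset.mul_sum]

theorem transplant_add_transplant (hℓ : ∀ i, 0 < ℓ i) (hℓ' : ∀ i, 0 < ℓ' i)
    (hσ : ∀ i, ℓ' i = ℓ (σ i)) (F : Fin n × Fin d → ℝ → ℂ) (e : Fin n × Fin d) {x : ℝ}
    (hx : x ∈ Icc 0 (ℓ' e.1)) :
    transplant (Γ₁ := pumpkinChain d ℓ hℓ) (Γ₂ := pumpkinChain d ℓ' hℓ') (fun _ _ => (d : ℂ)⁻¹)
        (symShift ℓ ℓ') F e x +
      transplant (Γ₁ := pumpkinChain d ℓ hℓ) (Γ₂ := pumpkinChain d ℓ' hℓ') (zeroMeanWeight σ)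
        (fun e' _ => ℓ' e'.1) F e x = reflectChain ℓ ℓ' σ F e x := by
  obtain ⟨k, j⟩ := e
  simp only at hx
  refine congrArg₂ (· + ·) ?_ ?_
  · refine (Fintype.sum_prod_type _).trans (Finset.sum_congr rfl fun i _ => ?_)
    rw [indicator_chainMean]
    refine Finset.sum_congr rfl fun j _ => ?_
    have h : ∑ i, ℓ i - Fin.partialSum ℓ' k.castSucc - Fin.partialSum ℓ i.castSucc - x =
        ∑ i, ℓ i - Fin.partialSum ℓ' k.castSucc - x - Fin.partialSum ℓ i.castSucc := by ring
    exact congrArg (fun y => (d : ℂ)⁻¹ * (Icc 0 (ℓ i)).indicator (F (i, j)) y) h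
  · refine (Fintype.sum_prod_type _).trans ?_
    rw [Finset.sum_eq_single (σ k) (fun i _ hi => ?_) (by simp)]
    · have hmem : ℓ' k - x ∈ Icc 0 (ℓ (σ k)) := by
        rw [← hσ]
        constructor <;> linarith [hx.1, hx.2]
      have h : ∀ j', zeroMeanWeight σ (k, j) (σ k, j') *
          (Icc 0 (ℓ (σ k))).indicator (F (σ k, j')) (ℓ' k - x) =
          (if j' = j then F (σ k, j') (ℓ' k - x) else 0) - (d : ℂ)⁻¹ * F (σ k, j') (ℓ' k - x) :=
        fun j' => by
          rw [indicator_of_mem hmem, zeroMeanWeight, if_pos rfl, sub_mul, ite_mul, one_mul, zero_mul]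
      refine (Finset.sum_congr rfl fun j' _ => h j').trans ?_
      rw [Finset.sum_sub_distrib, ← Finset.mul_sum, Finset.sum_ite_eq' Finset.univ j]
      simp [chainMean]
    · refine Finset.sum_eq_zero fun j' _ => ?_
      have h : zeroMeanWeight σ (k, j) (i, j') = 0 := if_neg hi
      exact (congrArg (· * _) h).trans (zero_mul _)

/-- The operator between the `L²` spaces of two chains given by `reflectChain`. -/
noncomputable def reflectChainL2 (d : ℕ) (hℓ : ∀ i, 0 < ℓ i) (hℓ' : ∀ i, 0 < ℓ' i)
    (σ : Equiv.Perm (Fin n)) : (pumpkinChain d ℓ hℓ).L2 →L[ℂ] (pumpkinChain d ℓ' hℓ').L2 :=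
  transplantL2 (fun _ _ => (d : ℂ)⁻¹) (symShift ℓ ℓ') +
    transplantL2 (zeroMeanWeight σ) (fun (e' : Fin n × Fin d) _ => ℓ' e'.1)

theorem coeFn_reflectChainL2 (hℓ : ∀ i, 0 < ℓ i) (hℓ' : ∀ i, 0 < ℓ' i)
    (hσ : ∀ i, ℓ' i = ℓ (σ i)) (f : (pumpkinChain d ℓ hℓ).L2) (e : Fin n × Fin d) :
    reflectChainL2 d hℓ hℓ' σ f e =ᵐ[volume.restrict (Icc 0 (ℓ' e.1))]
      reflectChain ℓ ℓ' σ (fun e => f e) e := by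
  have h1 := coeFn_transplantL2 (Γ₁ := pumpkinChain d ℓ hℓ) (Γ₂ := pumpkinChain d ℓ' hℓ')
    (fun _ _ => (d : ℂ)⁻¹) (symShift ℓ ℓ') f e
  have h2 := coeFn_transplantL2 (Γ₁ := pumpkinChain d ℓ hℓ) (Γ₂ := pumpkinChain d ℓ' hℓ')
    (zeroMeanWeight σ) (fun e' _ => ℓ' e'.1) f e
  have h3 := (Lp.coeFn_add _ _).trans (h1.add h2)
  refine Filter.EventuallyEq.trans h3 ?_
  filter_upwards [ae_restrict_mem measurableSet_Icc] with x hx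
  exact transplant_add_transplant hℓ hℓ' hσ (fun e => f e) e hx

theorem reflectChain_congr (hℓ : ∀ i, 0 < ℓ i) (hℓ' : ∀ i, 0 < ℓ' i)
    (hσ : ∀ i, ℓ' i = ℓ (σ i)) {F G : Fin n × Fin d → ℝ → ℂ}
    (h : ∀ e, F e =ᵐ[volume.restrict (Icc 0 (ℓ e.1))] G e) (e : Fin n × Fin d) :
    reflectChain ℓ ℓ' σ F e =ᵐ[volume.restrict (Icc 0 (ℓ' e.1))] reflectChain ℓ ℓ' σ G e := by
  have h1 := transplant_congr (Γ₁ := pumpkinChain d ℓ hℓ) (Γ₂ := pumpkinChain d ℓ' hℓ')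
    (fun _ _ => (d : ℂ)⁻¹) (symShift ℓ ℓ') h e
  have h2 := transplant_congr (Γ₁ := pumpkinChain d ℓ hℓ) (Γ₂ := pumpkinChain d ℓ' hℓ')
    (zeroMeanWeight σ) (fun e' _ => ℓ' e'.1) h e
  filter_upwards [ae_restrict_of_ae h1, ae_restrict_of_ae h2,
    ae_restrict_mem measurableSet_Icc] with x h1 h2 hx
  rw [← transplant_add_transplant hℓ hℓ' hσ F e hx, ← transplant_add_transplant hℓ hℓ' hσ G e hx,
    h1, h2]

theorem reflectChainL2_reflectChainL2 (hd : 1 ≤ d) (hℓ : ∀ i, 0 < ℓ i) (hℓ' : ∀ i, 0 < ℓ' i)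
    (hσ : ∀ i, ℓ' i = ℓ (σ i)) (f : (pumpkinChain d ℓ hℓ).L2) :
    reflectChainL2 d hℓ' hℓ σ⁻¹ (reflectChainL2 d hℓ hℓ' σ f) = f := by
  have hσ' : ∀ i, ℓ i = ℓ' (σ⁻¹ i) := fun i => by simp [hσ]
  ext1 e
  apply Lp.ext
  refine (coeFn_reflectChainL2 hℓ' hℓ hσ' _ e).trans ?_
  refine (reflectChain_congr hℓ' hℓ hσ' (coeFn_reflectChainL2 hℓ hℓ' hσ f) e).trans ?_
  have hcomp : ∀ᵐ x ∂(volume.restrict (Icc 0 (ℓ e.1))), x ∈ Ioo 0 (ℓ e.1) := by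
    rw [← restrict_Ioo_eq_restrict_Icc]
    exact ae_restrict_mem measurableSet_Ioo
  filter_upwards [hcomp, ae_restrict_of_ae (ae_sub_notMem_range ℓ'
    (∑ i, ℓ i - Fin.partialSum ℓ e.1.castSucc))] with x hx hr
  exact reflectChain_reflectChain hd hℓ hℓ' hσ _ e hx hr

/-- `reflectChainL2` as an isomorphism. -/
noncomputable def reflectChainEquiv (hd : 1 ≤ d) (hℓ : ∀ i, 0 < ℓ i) (hℓ' : ∀ i, 0 < ℓ' i)
    (hσ : ∀ i, ℓ' i = ℓ (σ i)) : (pumpkinChain d ℓ hℓ).L2 ≃L[ℂ] (pumpkinChain d ℓ' hℓ').L2 :=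
  ContinuousLinearEquiv.equivOfInverse (reflectChainL2 d hℓ hℓ' σ) (reflectChainL2 d hℓ' hℓ σ⁻¹)
    (reflectChainL2_reflectChainL2 hd hℓ hℓ' hσ) fun f => by
      have h := reflectChainL2_reflectChainL2 (σ := σ⁻¹) hd hℓ' hℓ (fun i => by simp [hσ]) f
      rwa [inv_inv] at h

end Chain

end MetricGraph

/-! ### Boundary equivalence of reflected chains -/

namespace MetricGraph

section ChainSolutions

variable {n d : ℕ} {ℓ ℓ' : Fin n → ℝ} {σ : Equiv.Perm (Fin n)}

/-- In a chain, functions with mean zero over parallel edges do not contribute to the sums of normal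
derivatives. -/
theorem normalDerivSum_pumpkinChain (hd : 1 ≤ d) (hℓ : ∀ i, 0 < ℓ i) (F' : Fin n × Fin d → ℝ → ℂ)
    (v : Fin (n + 1)) :
    (pumpkinChain d ℓ hℓ).normalDerivSum F' v =
      d * ∑ i : Fin n, ((if i.castSucc = v then chainMean F' i 0 else 0) -
        if i.succ = v then chainMean F' i (ℓ i) else 0) := by
  have hd' : (d : ℂ) ≠ 0 := by exact_mod_cast (by omega : d ≠ 0)
  refine (Fintype.sum_prod_type _).trans ?_
  rw [Finset.mul_sum]
  refine Finset.sum_congr rfl fun i _ => ?_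
  rw [mul_sub]
  simp only [chainMean, mul_ite, mul_zero, mul_inv_cancel_left₀ hd']
  refine (Finset.sum_sub_distrib _ _).trans (congrArg₂ (· - ·) ?_ ?_)
  · by_cases h : i.castSucc = v
    · rw [if_pos h]
      exact Finset.sum_congr rfl fun j _ => if_pos h
    · rw [if_neg h]
      exact Finset.sum_eq_zero fun j _ => if_neg h
  · by_cases h : i.succ = v
    · rw [if_pos h]
      exact Finset.sum_congr rfl fun j _ => if_pos h
    · rw [if_neg h]
      exact Finset.sum_eq_zero fun j _ => if_neg h

/-- If the means of the normal derivatives agree from both sides at each vertex, with the value `t`,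
they cancel at the inner vertices, and only the contributions of the ends remain. -/
theorem normalDerivSum_pumpkinChain_of_eq (hd : 1 ≤ d) (hℓ : ∀ i, 0 < ℓ i)
    {F' : Fin n × Fin d → ℝ → ℂ} {t : Fin (n + 1) → ℂ}
    (h₀ : ∀ i, chainMean F' i 0 = t i.castSucc) (h₁ : ∀ i, chainMean F' i (ℓ i) = t i.succ)
    (v : Fin (n + 1)) :
    (pumpkinChain d ℓ hℓ).normalDerivSum F' v =
      d * (t v * ((if v = Fin.last n then 0 else 1) - if v = 0 then 0 else 1)) := by
  rw [normalDerivSum_pumpkinChain hd]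
  have e₀ : ∀ i : Fin n, (if i.castSucc = v then chainMean F' i 0 else 0) =
      t v * if i.castSucc = v then 1 else 0 := fun i => by
    split_ifs with h
    · rw [h₀, h, mul_one]
    · rw [mul_zero]
  have e₁ : ∀ i : Fin n, (if i.succ = v then chainMean F' i (ℓ i) else 0) =
      t v * if i.succ = v then 1 else 0 := fun i => by
    split_ifs with h
    · rw [h₁, h, mul_one]
    · rw [mul_zero]
  simp only [e₀, e₁, Finset.sum_sub_distrib, ← Finset.mul_sum, ← mul_sub]
  congr 3
  · cases v using Fin.lastCases with
    | last => simp [Fin.castSucc_ne_last]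
    | cast k => simp [Fin.castSucc_ne_last]
  · cases v using Fin.cases with
    | zero => simp
    | succ k => simp

theorem hasDerivWithinAt_chainMean {F F' : Fin n × Fin d → ℝ → ℂ} {i : Fin n} {x : ℝ} {s : Set ℝ}
    (h : ∀ j, HasDerivWithinAt (F (i, j)) (F' (i, j) x) s x) :
    HasDerivWithinAt (chainMean F i) (chainMean F' i x) s x :=
  (HasDerivWithinAt.fun_sum fun j _ => h j).const_mul _

theorem chainMean_eq_sub_integral {F' g : Fin n × Fin d → ℝ → ℂ} {i : Fin n} {x : ℝ}
    (hx : x ∈ Icc 0 (ℓ i)) (hg : ∀ j, IntegrableOn (g (i, j)) (Icc 0 (ℓ i)))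
    (h : ∀ j, F' (i, j) x = F' (i, j) 0 - ∫ t in (0 : ℝ)..x, g (i, j) t) :
    chainMean F' i x = chainMean F' i 0 - ∫ t in (0 : ℝ)..x, chainMean g i t := by
  have hgi : ∀ j, IntervalIntegrable (g (i, j)) volume 0 x := fun j => by
    rw [intervalIntegrable_iff_integrableOn_Ioc_of_le hx.1]
    exact (hg j).mono_set (Ioc_subset_Icc_self.trans (Icc_subset_Icc_right hx.2))
  simp only [chainMean]
  rw [intervalIntegral.integral_const_mul,
    intervalIntegral.integral_finsetSum fun j _ => hgi j, ← mul_sub, ← Finset.sum_sub_distrib]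
  exact congrArg _ (Finset.sum_congr rfl fun j _ => h j)

theorem integral_concat (hℓ : ∀ i, 0 < ℓ i) (g : Fin n × Fin d → ℝ → ℂ) {i : Fin n} {x : ℝ}
    (hx : x ∈ Icc 0 (ℓ i)) :
    ∫ t in Fin.partialSum ℓ i.castSucc..Fin.partialSum ℓ i.castSucc + x, concat ℓ g t =
      ∫ t in (0 : ℝ)..x, chainMean g i t := by
  have h1 := intervalIntegral.integral_comp_add_left (a := 0) (b := x) (concat ℓ g)
    (Fin.partialSum ℓ i.castSucc)
  rw [add_zero] at h1
  rw [← h1, intervalIntegral.integral_of_le hx.1, intervalIntegral.integral_of_le hx.1,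
    integral_Ioc_eq_integral_Ioo, integral_Ioc_eq_integral_Ioo]
  refine setIntegral_congr_fun measurableSet_Ioo fun t ht => ?_
  have h2 : Fin.partialSum ℓ i.castSucc + t - Fin.partialSum ℓ i.castSucc = t := by ring
  rw [concat_of_mem_Ioo (i := i) hℓ, h2]
  rw [h2]
  exact ⟨ht.1, ht.2.trans_le hx.2⟩

/-- A Kirchhoff condition at an inner vertex of a chain, in terms of the symmetric part. -/
theorem chainMean_eq_of_normalDerivSum_eq_zero (hd : 1 ≤ d) (hℓ : ∀ i, 0 < ℓ i)
    {F' : Fin n × Fin d → ℝ → ℂ} {i k : Fin n} (hik : i.castSucc = k.succ)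
    (h : (pumpkinChain d ℓ hℓ).normalDerivSum F' k.succ = 0) :
    chainMean F' k (ℓ k) = chainMean F' i 0 := by
  have hd' : (d : ℂ) ≠ 0 := by exact_mod_cast (by omega : d ≠ 0)
  rw [normalDerivSum_pumpkinChain hd, mul_eq_zero_iff_left hd', Finset.sum_sub_distrib,
    sub_eq_zero] at h
  simp only [← hik, Fin.castSucc_inj] at h
  simp only [hik, Fin.succ_inj] at h
  simpa using h.symm

/-- The symmetric part of a function on a chain that satisfies the Kirchhoff conditions at the inner
vertices is an `H²` function on an interval. It is obtained by integrating its second derivative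
twice, so that no differentiability at the breakpoints has to be checked. -/
theorem exists_symmetricPart (hd : 1 ≤ d) (hn : 1 ≤ n) (hℓ : ∀ i, 0 < ℓ i)
    {F F' g : Fin n × Fin d → ℝ → ℂ} {φ η : Fin (n + 1) → ℂ}
    (h : (pumpkinChain d ℓ hℓ).IsWeakPair F F' g φ η)
    (hη : ∀ v, v ≠ 0 → v ≠ Fin.last n → η v = 0) :
    ∃ s s' : ℝ → ℂ, (∀ y, HasDerivAt s (s' y) y) ∧
      (∀ a b, s' b = s' a - ∫ t in a..b, concat ℓ g t) ∧
      (∀ v, s (Fin.partialSum ℓ v) = φ v) ∧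
      ∀ i, ∀ x ∈ Icc 0 (ℓ i), s (Fin.partialSum ℓ i.castSucc + x) = chainMean F i x ∧
        s' (Fin.partialSum ℓ i.castSucc + x) = chainMean F' i x := by
  have hg : Integrable (concat ℓ g) := integrable_concat fun e => h.integrable e
  have hgi : ∀ a b, IntervalIntegrable (concat ℓ g) volume a b := fun a b =>
    hg.intervalIntegrable
  have hv0 : ∀ i j, F (i, j) 0 = φ i.castSucc := fun i j => (h.vertexValues (i, j)).1
  have hv1 : ∀ i j, F (i, j) (ℓ i) = φ i.succ := fun i j => (h.vertexValues (i, j)).2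
  have hF0 : ∀ i, chainMean F i 0 = φ i.castSucc := fun i => chainMean_const hd (hv0 i)
  have hF1 : ∀ i, chainMean F i (ℓ i) = φ i.succ := fun i => chainMean_const hd (hv1 i)
  have hFd : ∀ i, ∀ x ∈ Icc 0 (ℓ i),
      HasDerivWithinAt (chainMean F i) (chainMean F' i x) (Icc 0 (ℓ i)) x := fun i x hx =>
    hasDerivWithinAt_chainMean (F := F) (F' := F') fun j => h.deriv_fst (i, j) x hx
  have hF'i : ∀ i, ∀ x ∈ Icc 0 (ℓ i),
      chainMean F' i x = chainMean F' i 0 - ∫ t in (0 : ℝ)..x, chainMean g i t := fun i x hx =>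
    chainMean_eq_sub_integral (F' := F') (g := g) hx (fun j => h.integrable (i, j))
      fun j => h.deriv_snd (i, j) x hx
  set s' : ℝ → ℂ := fun y => chainMean F' ⟨0, hn⟩ 0 - ∫ t in (0 : ℝ)..y, concat ℓ g t
  have hs' : ∀ a b, s' b = s' a - ∫ t in a..b, concat ℓ g t := fun a b => by
    simp only [s']
    rw [← intervalIntegral.integral_add_adjacent_intervals (hgi 0 a) (hgi a b)]
    ring
  have hs'c : Continuous s' :=
    continuous_const.sub (intervalIntegral.continuous_primitive hgi 0)
  set s : ℝ → ℂ := fun y => φ 0 + ∫ t in (0 : ℝ)..y, s' t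
  have hs : ∀ y, HasDerivAt s (s' y) y := fun y =>
    (hs'c.integral_hasStrictDerivAt 0 y).hasDerivAt.const_add _
  -- On each pumpkin, agreement at the left end propagates.
  have hedge : ∀ i, s (Fin.partialSum ℓ i.castSucc) = chainMean F i 0 →
      s' (Fin.partialSum ℓ i.castSucc) = chainMean F' i 0 →
      ∀ x ∈ Icc 0 (ℓ i), s (Fin.partialSum ℓ i.castSucc + x) = chainMean F i x ∧
        s' (Fin.partialSum ℓ i.castSucc + x) = chainMean F' i x := by
    intro i h0 h0'
    have hs'x : ∀ x ∈ Icc 0 (ℓ i),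
        s' (Fin.partialSum ℓ i.castSucc + x) = chainMean F' i x := fun x hx => by
      rw [hs' (Fin.partialSum ℓ i.castSucc), integral_concat hℓ g hx, h0', ← hF'i i x hx]
    have hder : ∀ x ∈ Icc 0 (ℓ i), HasDerivWithinAt
        (fun x => s (Fin.partialSum ℓ i.castSucc + x) - chainMean F i x) 0 (Icc 0 (ℓ i)) x := by
      intro x hx
      have h1 := ((hs _).comp_const_add (Fin.partialSum ℓ i.castSucc) x).hasDerivWithinAt.sub
        (hFd i x hx)
      rwa [hs'x x hx, sub_self] at h1
    intro x hx
    refine ⟨?_, hs'x x hx⟩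
    have h1 := constant_of_derivWithin_zero
      (fun x hx => (hder x hx).differentiableWithinAt)
      (fun x hx => (hder x (Ico_subset_Icc_self hx)).derivWithin
        (uniqueDiffOn_Icc (hℓ i) x (Ico_subset_Icc_self hx))) x hx
    rw [add_zero, h0, sub_self] at h1
    exact sub_eq_zero.1 h1
  have hvert : ∀ v, s (Fin.partialSum ℓ v) = φ v ∧
      ∀ i : Fin n, i.castSucc = v → s' (Fin.partialSum ℓ v) = chainMean F' i 0 := by
    intro v
    induction v using Fin.induction with
    | zero =>
      refine ⟨by simp [s], fun i hi => ?_⟩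
      obtain rfl : i = ⟨0, hn⟩ := Fin.ext (by simpa using congrArg Fin.val hi)
      simp [s']
    | succ k ih =>
      have h1 := hedge k (ih.1.trans (hF0 k).symm) (ih.2 k rfl) (ℓ k) (right_mem_Icc.2 (hℓ k).le)
      rw [← Fin.partialSum_succ] at h1
      exact ⟨h1.1.trans (hF1 k), fun i hi => h1.2.trans <|
        chainMean_eq_of_normalDerivSum_eq_zero hd hℓ hi ((h.normalDeriv k.succ).trans <|
          hη _ (Fin.succ_ne_zero k) (by rw [← hi]; exact Fin.castSucc_ne_last i))⟩
  exact ⟨s, s', hs, hs', fun v => (hvert v).1, fun i =>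
    hedge i ((hvert _).1.trans (hF0 i).symm) ((hvert _).2 i rfl)⟩

theorem mapsTo_sub_left_Icc (a : ℝ) : MapsTo (fun x => a - x) (Icc 0 a) (Icc 0 a) :=
  fun x hx => by constructor <;> linarith [hx.1, hx.2]

theorem hasDerivWithinAt_comp_sub_left {u : ℝ → ℂ} {u' : ℂ} {a x : ℝ}
    (h : HasDerivWithinAt u u' (Icc 0 a) (a - x)) :
    HasDerivWithinAt (fun x => u (a - x)) (-u') (Icc 0 a) x := by
  have h1 := HasDerivWithinAt.scomp x h ((hasDerivWithinAt_id x (Icc 0 a)).const_sub a)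
    (mapsTo_sub_left_Icc a)
  exact h1.congr_deriv (by simp)

theorem integrableOn_comp_sub_left {u : ℝ → ℂ} {a : ℝ} (ha : 0 ≤ a)
    (h : IntegrableOn u (Icc 0 a)) : IntegrableOn (fun x => u (a - x)) (Icc 0 a) := by
  rw [← intervalIntegrable_iff_integrableOn_Icc_of_le ha] at h ⊢
  simpa using (h.comp_sub_left a).symm

theorem integral_comp_sub_left_of_eq {u' g : ℝ → ℂ} {a x : ℝ}
    (hg : IntegrableOn g (Icc 0 a)) (h : ∀ y ∈ Icc 0 a, u' y = u' 0 - ∫ t in (0 : ℝ)..y, g t)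
    (hx : x ∈ Icc 0 a) : ∫ t in (0 : ℝ)..x, g (a - t) = u' (a - x) - u' a := by
  have ha : 0 ≤ a := hx.1.trans hx.2
  have hgi : ∀ y ∈ Icc 0 a, IntervalIntegrable g volume 0 y := fun y hy => by
    rw [intervalIntegrable_iff_integrableOn_Icc_of_le hy.1]
    exact hg.mono_set (Icc_subset_Icc_right hy.2)
  have hax := mapsTo_sub_left_Icc a hx
  rw [intervalIntegral.integral_comp_sub_left, sub_zero, h _ hax, h a (right_mem_Icc.2 ha),
    ← intervalIntegral.integral_interval_sub_left (hgi a (right_mem_Icc.2 ha)) (hgi _ hax)]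
  ring

/-- Reflection of chains takes solutions of `-F'' = g` to solutions, preserves the Kirchhoff
conditions at the inner vertices, and exchanges the boundary data at the ends. -/
theorem isWeakPair_reflectChain (hd : 1 ≤ d) (hn : 1 ≤ n) (hℓ : ∀ i, 0 < ℓ i)
    (hℓ' : ∀ i, 0 < ℓ' i) (hσ : ∀ i, ℓ' i = ℓ (σ i))
    {F F' g : Fin n × Fin d → ℝ → ℂ} {φ η : Fin (n + 1) → ℂ}
    (h : (pumpkinChain d ℓ hℓ).IsWeakPair F F' g φ η)
    (hη : ∀ v, v ≠ 0 → v ≠ Fin.last n → η v = 0) :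
    ∃ (G G' : Fin n × Fin d → ℝ → ℂ) (φ' η' : Fin (n + 1) → ℂ),
      (∀ e, reflectChain ℓ ℓ' σ F e =ᵐ[volume.restrict (Icc 0 (ℓ' e.1))] G e) ∧
      (pumpkinChain d ℓ' hℓ').IsWeakPair G G' (reflectChain ℓ ℓ' σ g) φ' η' ∧
      (∀ v, v ≠ 0 → v ≠ Fin.last n → η' v = 0) ∧
      φ' 0 = φ (Fin.last n) ∧ φ' (Fin.last n) = φ 0 ∧
      η' 0 = η (Fin.last n) ∧ η' (Fin.last n) = η 0 := by
  have hL : ∑ i, ℓ' i = ∑ i, ℓ i := by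
    simp only [hσ]
    exact Equiv.sum_comp σ ℓ
  have hv0 : ∀ i j, F (i, j) 0 = φ i.castSucc := fun i j => (h.vertexValues (i, j)).1
  have hv1 : ∀ i j, F (i, j) (ℓ i) = φ i.succ := fun i j => (h.vertexValues (i, j)).2
  have hFd : ∀ i j, ∀ x ∈ Icc 0 (ℓ i),
      HasDerivWithinAt (F (i, j)) (F' (i, j) x) (Icc 0 (ℓ i)) x := fun i j => h.deriv_fst (i, j)
  have hF'i : ∀ i j, ∀ x ∈ Icc 0 (ℓ i), F' (i, j) x = F' (i, j) 0 - ∫ t in (0 : ℝ)..x, g (i, j) t :=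
    fun i j => h.deriv_snd (i, j)
  have hgi : ∀ i j, IntegrableOn (g (i, j)) (Icc 0 (ℓ i)) := fun i j => h.integrable (i, j)
  have hgm : ∀ i, IntegrableOn (chainMean g i) (Icc 0 (ℓ i)) := fun i =>
    integrableOn_chainMean (hgi i)
  have hgc : Integrable (concat ℓ g) := integrable_concat fun e => h.integrable e
  obtain ⟨s, s', hs, hs', hsv, hse⟩ := exists_symmetricPart hd hn hℓ h hη
  have hη' : ∀ v, η v = d * (s' (Fin.partialSum ℓ v) *
      ((if v = Fin.last n then 0 else 1) - if v = 0 then 0 else 1)) := fun v => by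
    refine (h.normalDeriv v).symm.trans (normalDerivSum_pumpkinChain_of_eq hd hℓ
      (t := fun v => s' (Fin.partialSum ℓ v)) (fun i => ?_) (fun i => ?_) v)
    · have := (hse i 0 (left_mem_Icc.2 (hℓ i).le)).2
      rw [add_zero] at this
      exact this.symm
    · rw [Fin.partialSum_succ]
      exact ((hse i _ (right_mem_Icc.2 (hℓ i).le)).2).symm
  -- The point of the old interval that corresponds to a vertex of the new, reflected chain.
  set A : Fin (n + 1) → ℝ := fun v => ∑ i, ℓ i - Fin.partialSum ℓ' v with hA
  have hAs : ∀ i : Fin n, A i.succ = A i.castSucc - ℓ' i := fun i => by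
    simp only [hA, Fin.partialSum_succ]
    ring
  have hA0 : A 0 = Fin.partialSum ℓ (Fin.last n) := by
    simp only [hA, Fin.partialSum_zero, partialSum_last_eq_sum, sub_zero]
  have hAl : A (Fin.last n) = Fin.partialSum ℓ 0 := by
    simp only [hA, Fin.partialSum_zero, partialSum_last_eq_sum, hL, sub_self]
  set G' : Fin n × Fin d → ℝ → ℂ := fun e x => -(s' (A e.1.castSucc - x) +
    (F' (σ e.1, e.2) (ℓ' e.1 - x) - chainMean F' (σ e.1) (ℓ' e.1 - x))) with hG'
  have hmean : ∀ i x, chainMean G' i x = -s' (A i.castSucc - x) := fun i x => by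
    rw [chainMean]
    simp only [hG', Finset.sum_neg_distrib, mul_neg]
    rw [chainMean_add_sub_mean hd F' (σ i) (ℓ' i - x)]
  refine ⟨fun e x => s (A e.1.castSucc - x) +
      (F (σ e.1, e.2) (ℓ' e.1 - x) - chainMean F (σ e.1) (ℓ' e.1 - x)), G',
    fun v => s (A v), fun v => d * (-s' (A v) *
      ((if v = Fin.last n then 0 else 1) - if v = 0 then 0 else 1)), ?_,
    ⟨?_, ?_, ?_, ?_, fun v => normalDerivSum_pumpkinChain_of_eq hd hℓ'
      (t := fun v => -s' (A v)) (fun i => ?_) (fun i => ?_) v⟩, ?_, ?_, ?_, ?_, ?_⟩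
  · rintro ⟨i, j⟩
    filter_upwards [ae_restrict_mem measurableSet_Icc,
      ae_restrict_of_ae (ae_sub_notMem_range ℓ (A i.castSucc))] with x hx hr
    have h0 := partialSum_castSucc_nonneg hℓ' i
    have h1 := partialSum_castSucc_add_le hℓ' i
    change x ∈ Icc 0 (ℓ' i) at hx
    obtain ⟨k, hk⟩ := exists_mem_Ioo_of_notMem_range (ℓ := ℓ) (y := A i.castSucc - x)
      (by simp only [hA]; constructor <;> linarith [hx.1, hx.2]) hr
    have h2 := (hse k _ (Ioo_subset_Icc_self hk)).1
    rw [add_sub_cancel] at h2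
    simp only [reflectChain]
    rw [h2, concat_of_mem_Ioo hℓ F hk]
  · rintro ⟨i, j⟩
    have h1 : Integrable (fun x => concat ℓ g (A i.castSucc - x)) := hgc.comp_sub_left _
    have h2 := integrableOn_comp_sub_left (hℓ _).le (hgi (σ i) j)
    have h3 := integrableOn_comp_sub_left (hℓ _).le (hgm (σ i))
    rw [← hσ] at h2 h3
    exact h1.integrableOn.add (h2.sub h3)
  · rintro ⟨i, j⟩ x hx
    change x ∈ Icc 0 (ℓ' i) at hx
    have hx' : ℓ' i - x ∈ Icc 0 (ℓ (σ i)) := by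
      rw [← hσ]
      exact mapsTo_sub_left_Icc _ hx
    have h1 := ((hs (A i.castSucc - x)).comp_const_sub (A i.castSucc) x).hasDerivWithinAt
      (s := Icc 0 (ℓ' i))
    have h2 := hFd (σ i) j _ hx'
    have h3 := hasDerivWithinAt_chainMean (F := F) (F' := F') fun j => hFd (σ i) j _ hx'
    rw [← hσ] at h2 h3
    have h4 := h1.add ((hasDerivWithinAt_comp_sub_left h2).sub (hasDerivWithinAt_comp_sub_left h3))
    refine h4.congr_deriv ?_
    simp only [hG']
    ring
  · rintro ⟨i, j⟩ x hx
    change x ∈ Icc 0 (ℓ' i) at hx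
    have hx' : x ∈ Icc 0 (ℓ (σ i)) := by rwa [← hσ]
    have h1 : ∫ t in (0 : ℝ)..x, concat ℓ g (A i.castSucc - t) =
        s' (A i.castSucc - x) - s' (A i.castSucc) := by
      rw [intervalIntegral.integral_comp_sub_left, sub_zero,
        hs' (A i.castSucc - x) (A i.castSucc)]
      ring
    have h2 := integral_comp_sub_left_of_eq (hgi (σ i) j) (hF'i (σ i) j) hx'
    have h3 := integral_comp_sub_left_of_eq (u' := chainMean F' (σ i)) (hgm (σ i))
      (fun y hy => chainMean_eq_sub_integral hy (hgi (σ i)) fun j => hF'i (σ i) j y hy) hx'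
    have i1 : IntervalIntegrable (fun t => concat ℓ g (A i.castSucc - t)) volume 0 x :=
      (hgc.comp_sub_left _).intervalIntegrable
    have i2 : IntervalIntegrable (fun t => g (σ i, j) (ℓ (σ i) - t)) volume 0 x := by
      rw [intervalIntegrable_iff_integrableOn_Icc_of_le hx.1]
      exact (integrableOn_comp_sub_left (hℓ _).le (hgi (σ i) j)).mono_set
        (Icc_subset_Icc_right hx'.2)
    have i3 : IntervalIntegrable (fun t => chainMean g (σ i) (ℓ (σ i) - t)) volume 0 x := by
      rw [intervalIntegrable_iff_integrableOn_Icc_of_le hx.1]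
      exact (integrableOn_comp_sub_left (hℓ _).le (hgm (σ i))).mono_set
        (Icc_subset_Icc_right hx'.2)
    have h4 : ∫ t in (0 : ℝ)..x, reflectChain ℓ ℓ' σ g (i, j) t =
        (s' (A i.castSucc - x) - s' (A i.castSucc)) +
          ((F' (σ i, j) (ℓ (σ i) - x) - F' (σ i, j) (ℓ (σ i))) -
            (chainMean F' (σ i) (ℓ (σ i) - x) - chainMean F' (σ i) (ℓ (σ i)))) := by
      rw [← h1, ← h2, ← h3, ← intervalIntegral.integral_sub i2 i3,
        ← intervalIntegral.integral_add i1 (i2.sub i3), ← hσ]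
      rfl
    rw [h4]
    simp only [hG', hσ, sub_zero]
    ring
  · rintro ⟨i, j⟩
    have m0 : chainMean F (σ i) 0 = F (σ i, j) 0 :=
      chainMean_const hd fun j' => (hv0 _ j').trans (hv0 _ j).symm
    have m1 : chainMean F (σ i) (ℓ (σ i)) = F (σ i, j) (ℓ (σ i)) :=
      chainMean_const hd fun j' => (hv1 _ j').trans (hv1 _ j).symm
    constructor
    · change s (A i.castSucc - 0) + (F (σ i, j) (ℓ' i - 0) - chainMean F (σ i) (ℓ' i - 0)) =
        s (A i.castSucc)
      rw [sub_zero, sub_zero, hσ, m1, sub_self, add_zero]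
    · change s (A i.castSucc - ℓ' i) +
        (F (σ i, j) (ℓ' i - ℓ' i) - chainMean F (σ i) (ℓ' i - ℓ' i)) = s (A i.succ)
      rw [sub_self, m0, sub_self, add_zero, hAs]
  · rw [hmean, sub_zero]
  · rw [hmean, hAs]
  · intro v hv0 hvl
    simp [hv0, hvl]
  · simp only [hA0, hsv]
  · simp only [hAl, hsv]
  · have h0 := zero_ne_last_of_one_le hn
    simp only [hη', hA0, if_true, if_neg h0, if_neg h0.symm]
    ring
  · have h0 := zero_ne_last_of_one_le hn
    simp only [hη', hAl, if_true, if_neg h0, if_neg h0.symm]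
    ring

end ChainSolutions

/-! ### Exchanging the ends and permuting the pumpkins -/

section Ends

variable {n d : ℕ} {ℓ ℓ' : Fin n → ℝ} {σ : Equiv.Perm (Fin n)}

theorem intertwines_reflectChainL2 (hd : 1 ≤ d) (hn : 1 ≤ n) (hℓ : ∀ i, 0 < ℓ i)
    (hℓ' : ∀ i, 0 < ℓ' i) (hσ : ∀ i, ℓ' i = ℓ (σ i)) :
    Intertwines ![chainFirst d ℓ hℓ, chainLast d ℓ hℓ] ![chainLast d ℓ' hℓ', chainFirst d ℓ' hℓ']
      (reflectChainL2 d hℓ hℓ' σ) := by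
  intro f g φ η ⟨F, F', hF, h⟩ h0
  have h0' : ∀ v, v ≠ 0 → v ≠ Fin.last n → η v = 0 := fun v hv hv' => h0 v <| by
    rintro ⟨b, hb⟩
    fin_cases b
    · exact hv hb.symm
    · exact hv' hb.symm
  obtain ⟨G, G', φ', η', hG, hG', k, a0, al, b0, bl⟩ :=
    isWeakPair_reflectChain hd hn hℓ hℓ' hσ h h0'
  refine ⟨φ', η', ⟨G, G', fun e => ?_, hG'.congr fun e => (coeFn_reflectChainL2 hℓ hℓ' hσ g e).symm⟩,
    fun v hv => ?_, fun b => ?_, fun b => ?_⟩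
  · exact (coeFn_reflectChainL2 hℓ hℓ' hσ f e).trans
      ((reflectChain_congr hℓ hℓ' hσ hF e).trans (hG e))
  · exact k v (fun h => hv ⟨1, h.symm⟩) fun h => hv ⟨0, h.symm⟩
  · fin_cases b
    · exact al
    · exact a0
  · fin_cases b
    · exact bl
    · exact b0

theorem Intertwines.swap {C₁ C₂ : MetricGraph} {a b : C₁.V} {a' b' : C₂.V}
    {U : C₁.L2 →L[ℂ] C₂.L2} (hU : Intertwines ![a, b] ![a', b'] U) :
    Intertwines ![b, a] ![b', a'] U := by
  intro f g φ η h h0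
  simp only [Intertwines, Matrix.range_cons, Matrix.range_empty, union_comm,
    Fin.forall_fin_two, Matrix.cons_val_zero, Matrix.cons_val_one] at hU h0 ⊢
  obtain ⟨φ', η', h₁, h₂, h₃, h₄⟩ := hU f g φ η h (by simpa [or_comm] using h0)
  exact ⟨φ', η', h₁, by simpa [or_comm] using h₂, h₃.symm, h₄.symm⟩

/-- Chains of pumpkins that differ in the order of the pumpkins are boundary equivalent, with
exchanged ends. -/
theorem boundaryEquivalent_reflect (hd : 1 ≤ d) (hn : 1 ≤ n) (hℓ : ∀ i, 0 < ℓ i)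
    (hℓ' : ∀ i, 0 < ℓ' i) (hσ : ∀ i, ℓ' i = ℓ (σ i)) :
    BoundaryEquivalent ![chainFirst d ℓ hℓ, chainLast d ℓ hℓ]
      ![chainLast d ℓ' hℓ', chainFirst d ℓ' hℓ'] := by
  refine ⟨reflectChainEquiv hd hℓ hℓ' hσ, intertwines_reflectChainL2 hd hn hℓ hℓ' hσ, ?_⟩
  have hσ' : ∀ i, ℓ i = ℓ' (σ⁻¹ i) := fun i => by simp [hσ]
  exact (intertwines_reflectChainL2 hd hn hℓ' hℓ hσ').swap

/-- Chains of pumpkins that differ in the order of the pumpkins are boundary equivalent: reflect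
the whole chain twice, once with the permutation and once without. -/
theorem boundaryEquivalent_permute (hd : 1 ≤ d) (hn : 1 ≤ n) (hℓ : ∀ i, 0 < ℓ i)
    (hℓ' : ∀ i, 0 < ℓ' i) (hσ : ∀ i, ℓ' i = ℓ (σ i)) :
    BoundaryEquivalent ![chainFirst d ℓ hℓ, chainLast d ℓ hℓ]
      ![chainFirst d ℓ' hℓ', chainLast d ℓ' hℓ'] :=
  (boundaryEquivalent_reflect hd hn hℓ hℓ' hσ).trans
    (boundaryEquivalent_reflect (σ := 1) hd hn hℓ' hℓ' fun _ => rfl).symm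

theorem boundary_injective (d : ℕ) (hn : 1 ≤ n) (hℓ : ∀ i, 0 < ℓ i) :
    Function.Injective ![chainFirst d ℓ hℓ, chainLast d ℓ hℓ] := by
  rw [Function.Injective, Fin.forall_fin_two]
  have h0 : chainFirst d ℓ hℓ ≠ chainLast d ℓ hℓ := zero_ne_last_of_one_le hn
  simp [Fin.forall_fin_two, h0, h0.symm]

end Ends

/-! ### The `M`-function -/

section MFunction

variable {Γ : MetricGraph}

theorem IsInteriorSolution.isWeakPair {v : Γ.V} {k : ℂ} {F F' : Γ.E → ℝ → ℂ} {φ : Γ.V → ℂ}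
    (h : Γ.IsInteriorSolution v k F F' φ) :
    Γ.IsWeakPair F F' (fun e x => k ^ 2 * F e x) φ (Γ.normalDerivSum F') := by
  have hc : ∀ e, ContinuousOn (fun x => k ^ 2 * F e x) (Icc 0 (Γ.len e)) := fun e =>
    continuousOn_const.mul fun x hx => (h.deriv_fst e x hx).continuousWithinAt
  refine ⟨fun e => (hc e).integrableOn_Icc, h.deriv_fst, fun e x hx => ?_, h.vertexValues,
    fun _ => rfl⟩
  have hsub : Icc 0 x ⊆ Icc 0 (Γ.len e) := Icc_subset_Icc_right hx.2
  have h1 := intervalIntegral.integral_eq_sub_of_hasDerivAt_of_le (f := F' e)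
    (f' := fun x => -(k ^ 2 * F e x)) hx.1
    (fun y hy => (h.deriv_snd e y (hsub hy)).continuousWithinAt.mono hsub)
    (fun y hy => (h.deriv_snd e y (hsub (Ioo_subset_Icc_self hy))).hasDerivAt
      (Icc_mem_nhds hy.1 (hy.2.trans_le hx.2)))
    (by
      rw [intervalIntegrable_iff_integrableOn_Icc_of_le hx.1]
      exact ((hc e).neg.mono hsub).integrableOn_Icc)
  rw [intervalIntegral.integral_neg] at h1
  linear_combination -h1

/-- The integrated equation with the continuous right-hand side `k² F` is the differential equation. -/
theorem IsWeakPair.isInteriorSolution {v : Γ.V} {k : ℂ} {F F' : Γ.E → ℝ → ℂ} {φ η : Γ.V → ℂ}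
    (h : Γ.IsWeakPair F F' (fun e x => k ^ 2 * F e x) φ η) (hη : ∀ w, w ≠ v → η w = 0) :
    Γ.IsInteriorSolution v k F F' φ := by
  refine ⟨h.deriv_fst, fun e x hx => ?_, h.vertexValues, fun w hw =>
    (h.normalDeriv w).trans (hη w hw)⟩
  have hc : ContinuousOn (fun x => k ^ 2 * F e x) (Icc 0 (Γ.len e)) :=
    continuousOn_const.mul fun x hx => (h.deriv_fst e x hx).continuousWithinAt
  have : Fact (x ∈ Icc 0 (Γ.len e)) := ⟨hx⟩
  have h1 : HasDerivWithinAt (fun y => ∫ t in (0 : ℝ)..y, k ^ 2 * F e t) (k ^ 2 * F e x)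
      (Icc 0 (Γ.len e)) x := by
    refine intervalIntegral.integral_hasDerivWithinAt_right ?_
      (hc.stronglyMeasurableAtFilter_nhdsWithin measurableSet_Icc x) (hc x hx)
    rw [intervalIntegrable_iff_integrableOn_Icc_of_le hx.1]
    exact (hc.mono (Icc_subset_Icc_right hx.2)).integrableOn_Icc
  exact (h1.const_sub (F' e 0)).congr (fun y hy => h.deriv_snd e y hy) (h.deriv_snd e x hx)

variable {n d : ℕ} {ℓ : Fin n → ℝ}

theorem reflectChain_const_mul (ℓ' : Fin n → ℝ) (σ : Equiv.Perm (Fin n)) (c : ℂ)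
    (F : Fin n × Fin d → ℝ → ℂ) (e : Fin n × Fin d) (x : ℝ) :
    reflectChain ℓ ℓ' σ (fun e x => c * F e x) e x = c * reflectChain ℓ ℓ' σ F e x := by
  have hm : ∀ i y, chainMean (fun e x => c * F e x) i y = c * chainMean F i y := fun i y => by
    simp only [chainMean, ← Finset.mul_sum]
    ring
  have hi : ∀ i y, (Icc 0 (ℓ i)).indicator (chainMean (fun e x => c * F e x) i) y =
      c * (Icc 0 (ℓ i)).indicator (chainMean F i) y := fun i y => by
    by_cases hy : y ∈ Icc 0 (ℓ i) <;> simp only [hy, indicator_of_mem, indicator_of_notMem,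
      not_false_iff, hm, mul_zero]
  simp only [reflectChain, concat, hi, hm, ← Finset.mul_sum]
  ring

/-- Reflection of a chain takes a solution that fails the Kirchhoff condition only at one end to a
solution that fails it only at the other end, with the same data there. -/
theorem exists_isInteriorSolution_other_end (hd : 1 ≤ d) (hn : 1 ≤ n) (hℓ : ∀ i, 0 < ℓ i) {k : ℂ}
    {F F' : Fin n × Fin d → ℝ → ℂ} {φ : Fin (n + 1) → ℂ} {v v' : Fin (n + 1)}
    (hv : v = 0 ∧ v' = Fin.last n ∨ v = Fin.last n ∧ v' = 0)
    (h : (pumpkinChain d ℓ hℓ).IsInteriorSolution v k F F' φ) :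
    ∃ G G' φ', (pumpkinChain d ℓ hℓ).IsInteriorSolution v' k G G' φ' ∧ φ' v' = φ v ∧
      (pumpkinChain d ℓ hℓ).normalDerivSum G' v' = (pumpkinChain d ℓ hℓ).normalDerivSum F' v := by
  have h0 := zero_ne_last_of_one_le hn
  have hσ : ∀ i, ℓ i = ℓ ((1 : Equiv.Perm (Fin n)) i) := fun _ => rfl
  obtain ⟨G, G', φ', η', hG, hG', hη', a0, al, b0, bl⟩ :=
    isWeakPair_reflectChain hd hn hℓ hℓ hσ h.isWeakPair fun w hw hw' => h.neumann w <| by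
      rcases hv with ⟨rfl, -⟩ | ⟨rfl, -⟩
      · exact hw
      · exact hw'
  have hG'' := hG'.congr (g₁ := fun e x => k ^ 2 * G e x) fun e => by
    filter_upwards [hG e] with x hx
    exact (reflectChain_const_mul ℓ 1 (k ^ 2) F e x).trans (congrArg _ hx)
  refine ⟨G, G', φ', hG''.isInteriorSolution fun (w : Fin (n + 1)) hw => ?_, ?_, ?_⟩
  · by_cases hw0 : w = 0
    · rcases hv with ⟨rfl, rfl⟩ | ⟨rfl, rfl⟩
      · rw [hw0, b0]
        exact h.neumann _ h0.symm
      · exact absurd hw0 hw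
    · by_cases hwl : w = Fin.last n
      · rcases hv with ⟨rfl, rfl⟩ | ⟨rfl, rfl⟩
        · exact absurd hwl hw
        · rw [hwl, bl]
          exact h.neumann _ h0
      · exact hη' w hw0 hwl
  · rcases hv with ⟨rfl, rfl⟩ | ⟨rfl, rfl⟩
    · exact al
    · exact a0
  · refine (hG''.normalDeriv v').trans ?_
    rcases hv with ⟨rfl, rfl⟩ | ⟨rfl, rfl⟩
    · exact bl
    · exact b0

theorem isMValue_other_end (hd : 1 ≤ d) (hn : 1 ≤ n) (hℓ : ∀ i, 0 < ℓ i) {k m : ℂ}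
    {v v' : Fin (n + 1)} (hv : v = 0 ∧ v' = Fin.last n ∨ v = Fin.last n ∧ v' = 0)
    (h : (pumpkinChain d ℓ hℓ).IsMValue v k m) : (pumpkinChain d ℓ hℓ).IsMValue v' k m := by
  obtain ⟨⟨F, F', φ, hF, hφ⟩, hm⟩ := h
  refine ⟨?_, fun F F' φ hF => ?_⟩
  · obtain ⟨G, G', φ', hG, h₁, -⟩ := exists_isInteriorSolution_other_end hd hn hℓ hv hF
    exact ⟨G, G', φ', hG, by rwa [h₁]⟩
  · obtain ⟨G, G', φ', hG, h₁, h₂⟩ := exists_isInteriorSolution_other_end hd hn hℓ (v' := v)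
      (by tauto) hF
    rw [← h₁, ← h₂]
    exact hm G G' φ' hG

theorem mFunction_chainFirst_eq_chainLast (hd : 1 ≤ d) (hn : 1 ≤ n) (hℓ : ∀ i, 0 < ℓ i) :
    (pumpkinChain d ℓ hℓ).mFunction (chainFirst d ℓ hℓ) =
      (pumpkinChain d ℓ hℓ).mFunction (chainLast d ℓ hℓ) := by
  have h : (pumpkinChain d ℓ hℓ).IsMValue (chainFirst d ℓ hℓ) =
      (pumpkinChain d ℓ hℓ).IsMValue (chainLast d ℓ hℓ) := by
    funext k m
    exact propext ⟨isMValue_other_end hd hn hℓ (.inl ⟨rfl, rfl⟩),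
      isMValue_other_end hd hn hℓ (.inr ⟨rfl, rfl⟩)⟩
  exact congrArg (fun (P : ℂ → ℂ → Prop) k => (⟨∃ m, P k m, fun h => h.choose⟩ : Part ℂ)) h

end MFunction

/-! ### Attaching graphs -/

section Attach

variable {C₁ C₂ Γ : MetricGraph} {p₁ q₁ : C₁.V} {p₂ q₂ : C₂.V}

theorem BoundaryEquivalent.isospectral_attachTwo (h : BoundaryEquivalent ![p₁, q₁] ![p₂, q₂])
    (h₁ : Function.Injective ![p₁, q₁]) (h₂ : Function.Injective ![p₂, q₂]) (a b : Γ.V) :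
    (C₁.attachTwo p₁ q₁ Γ a b).Isospectral (C₂.attachTwo p₂ q₂ Γ a b) := by
  have key : ∀ {C : MetricGraph} (p q : C.V) (φ : C.V → ℂ) (ψ : Γ.V → ℂ),
      Compat (fun x y => (x = Sum.inl p ∧ y = Sum.inr a) ∨ (x = Sum.inl q ∧ y = Sum.inr b)) φ ψ ↔
        φ (![p, q] 0) = ψ a ∧ φ (![p, q] 1) = ψ b := by
    intro C p q φ ψ
    constructor
    · exact fun h => ⟨h _ _ (.inl ⟨rfl, rfl⟩), h _ _ (.inr ⟨rfl, rfl⟩)⟩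
    · rintro ⟨ha, hb⟩ x y (⟨rfl, rfl⟩ | ⟨rfl, rfl⟩)
      · exact ha
      · exact hb
  exact h.isospectral_glue h₁ h₂ (fun β ψ => β 0 = ψ a ∧ β 1 = ψ b) (key p₁ q₁) (key p₂ q₂)

theorem BoundaryEquivalent.isospectral_attach (h : BoundaryEquivalent ![p₁, q₁] ![p₂, q₂])
    (h₁ : Function.Injective ![p₁, q₁]) (h₂ : Function.Injective ![p₂, q₂]) (a : Γ.V) :
    (C₁.attach p₁ Γ a).Isospectral (C₂.attach p₂ Γ a) := by
  have key : ∀ {C : MetricGraph} (p q : C.V) (φ : C.V → ℂ) (ψ : Γ.V → ℂ),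
      Compat (fun x y => x = Sum.inl p ∧ y = Sum.inr a) φ ψ ↔ φ (![p, q] 0) = ψ a := by
    intro C p q φ ψ
    constructor
    · exact fun h => h _ _ ⟨rfl, rfl⟩
    · rintro ha x y ⟨rfl, rfl⟩
      exact ha
  exact h.isospectral_glue h₁ h₂ (fun β ψ => β 0 = ψ a) (key p₁ q₁) (key p₂ q₂)

end Attach

end MetricGraph

theorem theorem2 (d n : ℕ) (hd : 1 ≤ d) (hn : 1 ≤ n) (ℓ : Fin n → ℝ) (hℓ : ∀ i, 0 < ℓ i) :
    -- the spectrum does not depend on the order of the pumpkins, for the chain alone,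
    -- for two graphs attached to its ends, and for its ends attached to one graph
    (∀ σ : Equiv.Perm (Fin n),
      MetricGraph.Isospectral
        (MetricGraph.pumpkinChain d ℓ hℓ)
        (MetricGraph.pumpkinChain d (fun i => ℓ (σ i)) (fun i => hℓ (σ i))) ∧
      (∀ (Γ₁ : MetricGraph) (a : Γ₁.V) (Γ₂ : MetricGraph) (b : Γ₂.V),
        MetricGraph.Isospectral
          ((MetricGraph.pumpkinChain d ℓ hℓ).attachPair
            (MetricGraph.chainFirst d ℓ hℓ) (MetricGraph.chainLast d ℓ hℓ) Γ₁ a Γ₂ b)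
          ((MetricGraph.pumpkinChain d (fun i => ℓ (σ i)) (fun i => hℓ (σ i))).attachPair
            (MetricGraph.chainFirst d (fun i => ℓ (σ i)) (fun i => hℓ (σ i)))
            (MetricGraph.chainLast d (fun i => ℓ (σ i)) (fun i => hℓ (σ i))) Γ₁ a Γ₂ b)) ∧
      (∀ (Γ : MetricGraph) (a b : Γ.V),
        MetricGraph.Isospectral
          ((MetricGraph.pumpkinChain d ℓ hℓ).attachTwo
            (MetricGraph.chainFirst d ℓ hℓ) (MetricGraph.chainLast d ℓ hℓ) Γ a b)
          ((MetricGraph.pumpkinChain d (fun i => ℓ (σ i)) (fun i => hℓ (σ i))).attachTwo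
            (MetricGraph.chainFirst d (fun i => ℓ (σ i)) (fun i => hℓ (σ i)))
            (MetricGraph.chainLast d (fun i => ℓ (σ i)) (fun i => hℓ (σ i))) Γ a b))) ∧
    -- the two ends have the same `M`-function
    (MetricGraph.pumpkinChain d ℓ hℓ).mFunction (MetricGraph.chainFirst d ℓ hℓ) =
      (MetricGraph.pumpkinChain d ℓ hℓ).mFunction (MetricGraph.chainLast d ℓ hℓ) ∧
    -- and attaching a graph to one end or to the other gives isospectral graphs
    (∀ (Γ : MetricGraph) (a : Γ.V),
      MetricGraph.Isospectral
        ((MetricGraph.pumpkinChain d ℓ hℓ).attach (MetricGraph.chainFirst d ℓ hℓ) Γ a)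
        ((MetricGraph.pumpkinChain d ℓ hℓ).attach (MetricGraph.chainLast d ℓ hℓ) Γ a)) := by
  have hinj := @MetricGraph.boundary_injective n
  have hinj' : Function.Injective
      ![MetricGraph.chainLast d ℓ hℓ, MetricGraph.chainFirst d ℓ hℓ] := by
    have h := (hinj d hn hℓ).comp (Equiv.swap (0 : Fin 2) 1).injective
    convert h using 1
    funext b
    fin_cases b <;> rfl
  refine ⟨fun σ => ?_, MetricGraph.mFunction_chainFirst_eq_chainLast hd hn hℓ, fun Γ a => ?_⟩
  · have h := MetricGraph.boundaryEquivalent_permute (σ := σ) hd hn hℓ (fun i => hℓ (σ i))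
      fun _ => rfl
    exact ⟨h.isospectral,
      fun Γ₁ a Γ₂ b => h.isospectral_attachTwo (hinj d hn hℓ) (hinj d hn _) _ _,
      fun Γ a b => h.isospectral_attachTwo (hinj d hn hℓ) (hinj d hn _) a b⟩
  · exact (MetricGraph.boundaryEquivalent_reflect (σ := 1) hd hn hℓ hℓ
      fun _ => rfl).isospectral_attach (hinj d hn hℓ) hinj' a
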